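/- Let $p\in\{3,5,7,11\}$, let $\mathbb K$ be a field of characteristic $p$, and let $n\ge 2$, $m\ge 1$. Let $SL^{n,m}$ be the Lie superalgebra over $\mathbb K$ with even basis $X_1,\dots,X_n,T_1,T_2,T_3$ and odd basis $Y_1,\dots,Y_m$ whose only non-zero brackets, up to antisymmetry, are $$[X_1,X_i]=X_{i+1}\ (2\le i\le n-1),\quad [X_1,Y_j]=Y_{j+1}\ (1\le j\le m-1),\quad [T_1,X_i]=iX_i\ (1\le i\le n),$$ $$[T_1,Y_j]=jY_j\ (1\le j\le m),\quad [T_2,X_i]=X_i\ (2\le i\le n),\quad [T_3,Y_j]=Y_j\ (1\le j\le m),$$ graded over $\mathbb Z$ by $\deg X_r=r$, $\deg Y_s=n+s$, $\deg T_l=0$. Let $H^2(SL^{n,m};SL^{n,m})$ be its second (Lie superalgebra) cohomology space with adjoint coefficients, even and odd classes together. Let $c_1$ (if $m\ge p$) and $c_2$ (if $n\ge p+1$) be the bilinear maps $SL^{n,m}\times SL^{n,m}\to SL^{n,m}$ given on pairs of basis vectors by $c_1(X_1,Y_p)=Y_1=-c_1(Y_p,X_1)$, respectively $c_2(X_1,X_{p+1})=X_2=-c_2(X_{p+1},X_1)$,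 and zero on all other pairs. Then: 1. if $m<p$ and $n<p+1$, then $H^2(SL^{n,m};SL^{n,m})=0$; 2. if $m=p$ and $n<p+1$, then $H^2(SL^{n,m};SL^{n,m})$ is $1$-dimensional, spanned by the class of $c_1$, which is an even 2-cocycle, homogeneous of degree $-p$; 3. if $m<p$ and $n=p+1$, then $H^2(SL^{n,m};SL^{n,m})$ is $1$-dimensional, spanned by the class of $c_2$, which is an even 2-cocycle, homogeneous of degree $-p$; 4. if $m=p$ and $n=p+1$, then $H^2(SL^{n,m};SL^{n,m})$ is $2$-dimensional, spanned by the classes of $c_1$ and $c_2$, both even 2-cocycles, homogeneous of degree $-p$. -/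

import Mathlib

set_option maxSynthPendingDepth 3
set_option linter.unusedSimpArgs false

/-- A Lie superalgebra structure on a vector space `L` over a field `K` of characteristic
different from `2`: a `ℤ/2`-grading of `L` (`part 0` is the even part, `part 1` the odd part)
and an even bilinear bracket that is super-skew-symmetric and satisfies the graded Jacobi
identity. -/
structure LieSuperalgebra (K : Type*) [Field K] (L : Type*) [AddCommGroup L] [Module K L] where
  /-- the homogeneous components -/
  part : ZMod 2 → Submodule K L
  isCompl : IsCompl (part 0) (part 1)
  /-- the bracket -/
  bracket : L →ₗ[K] L →ₗ[K] L
  bracket_mem : ∀ (α β : ZMod 2) (x y : L), x ∈ part α → y ∈ part β →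
    bracket x y ∈ part (α + β)
  skew : ∀ (α β : ZMod 2) (x y : L), x ∈ part α → y ∈ part β →
    bracket x y = -((-1 : K) ^ (α.val * β.val) • bracket y x)
  jacobi : ∀ (α β γ : ZMod 2) (x y z : L), x ∈ part α → y ∈ part β → z ∈ part γ →
    (-1 : K) ^ (γ.val * α.val) • bracket x (bracket y z)
      + (-1 : K) ^ (α.val * β.val) • bracket y (bracket z x)
      + (-1 : K) ^ (β.val * γ.val) • bracket z (bracket x y) = 0

namespace LieSuperalgebra

variable {K : Type*} [Field K] {L : Type*} [AddCommGroup L] [Module K L]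

/-- The space `C²(𝔤; 𝔤) = Hom(Λ²𝔤₀ ⊕ 𝔤₀ ⊗ 𝔤₁ ⊕ S²𝔤₁, 𝔤)` of 2-cochains with adjoint
coefficients, even and odd cochains together, realized as the space of bilinear maps
`𝔤 × 𝔤 → 𝔤` that are alternating on even pairs, antisymmetric on mixed pairs and symmetric on
odd pairs (the characteristic is not `2`). -/
def C2 (G : LieSuperalgebra K L) : Submodule K (L →ₗ[K] L →ₗ[K] L) where
  carrier := {c | ∀ (α β : ZMod 2) (x y : L), x ∈ G.part α → y ∈ G.part β →
    c x y = -((-1 : K) ^ (α.val * β.val) • c y x)}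
  add_mem' := by
    intro c c' h h' α β x y hx hy
    simp only [LinearMap.add_apply, h α β x y hx hy, h' α β x y hx hy, smul_add, neg_add]
  zero_mem' := by
    intro α β x y hx hy
    simp
  smul_mem' := by
    intro r c h α β x y hx hy
    simp only [LinearMap.smul_apply, h α β x y hx hy, smul_neg, smul_comm r]

/-- The value at homogeneous elements `x, y` of parities `α, β` of the differential of a
1-cochain `b : 𝔤 → 𝔤`. -/
def d1 (G : LieSuperalgebra K L) (b : L →ₗ[K] L) (α β : ZMod 2) (x y : L) : L :=
  b (G.bracket x y) - G.bracket x (b y) + (-1 : K) ^ (α.val * β.val) • G.bracket y (b x)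

/-- The value at homogeneous elements `x, y, z` of parities `α, β, γ` of the differential of a
2-cochain `c`. For `x, y, z` ordered with the even elements first, this is the
Chevalley–Eilenberg differential on the component
`Hom(Λ^{q₀}𝔤₀ ⊗ S^{q₁}𝔤₁, 𝔤)` with `q₀ + q₁ = 3`. -/
def d2 (G : LieSuperalgebra K L) (c : L →ₗ[K] L →ₗ[K] L) (α β γ : ZMod 2) (x y z : L) : L :=
  c (G.bracket x y) z
    - (-1 : K) ^ (β.val * γ.val) • c (G.bracket x z) y
    + (-1 : K) ^ (α.val * (β.val + γ.val)) • c (G.bracket y z) x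
    - G.bracket x (c y z)
    + (-1 : K) ^ (α.val * β.val) • G.bracket y (c x z)
    - (-1 : K) ^ (γ.val * (α.val + β.val)) • G.bracket z (c x y)

/-- The space `Z²(𝔤; 𝔤)` of 2-cocycles. -/
def Z2 (G : LieSuperalgebra K L) : Submodule K (L →ₗ[K] L →ₗ[K] L) where
  carrier := {c | c ∈ G.C2 ∧ ∀ (α β γ : ZMod 2) (x y z : L),
    x ∈ G.part α → y ∈ G.part β → z ∈ G.part γ → G.d2 c α β γ x y z = 0}
  add_mem' := by
    rintro c c' ⟨h, hd⟩ ⟨h', hd'⟩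
    refine ⟨add_mem h h', fun α β γ x y z hx hy hz => ?_⟩
    have e : G.d2 (c + c') α β γ x y z = G.d2 c α β γ x y z + G.d2 c' α β γ x y z := by
      simp only [d2, LinearMap.add_apply, map_add]
      module
    rw [e, hd α β γ x y z hx hy hz, hd' α β γ x y z hx hy hz, add_zero]
  zero_mem' := ⟨zero_mem _, fun α β γ x y z _ _ _ => by simp [d2]⟩
  smul_mem' := by
    rintro r c ⟨h, hd⟩
    refine ⟨Submodule.smul_mem _ r h, fun α β γ x y z hx hy hz => ?_⟩
    have e : G.d2 (r • c) α β γ x y z = r • G.d2 c α β γ x y z := by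
      simp only [d2, LinearMap.smul_apply, map_smul]
      module
    rw [e, hd α β γ x y z hx hy hz, smul_zero]

/-- The space `B²(𝔤; 𝔤)` of 2-coboundaries: the bilinear maps that agree on homogeneous
elements with the differential of a linear map `b : 𝔤 → 𝔤`. -/
def B2 (G : LieSuperalgebra K L) : Submodule K (L →ₗ[K] L →ₗ[K] L) where
  carrier := {c | ∃ b : L →ₗ[K] L, ∀ (α β : ZMod 2) (x y : L),
    x ∈ G.part α → y ∈ G.part β → c x y = G.d1 b α β x y}
  add_mem' := by
    rintro c c' ⟨b, h⟩ ⟨b', h'⟩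
    refine ⟨b + b', fun α β x y hx hy => ?_⟩
    rw [LinearMap.add_apply, LinearMap.add_apply, h α β x y hx hy, h' α β x y hx hy]
    simp only [d1, LinearMap.add_apply, map_add]
    module
  zero_mem' := ⟨0, fun α β x y _ _ => by simp [d1]⟩
  smul_mem' := by
    rintro r c ⟨b, h⟩
    refine ⟨r • b, fun α β x y hx hy => ?_⟩
    rw [LinearMap.smul_apply, LinearMap.smul_apply, h α β x y hx hy]
    simp only [d1, LinearMap.smul_apply, map_smul]
    module

/-- The second cohomology space `H²(𝔤; 𝔤) = Z²(𝔤; 𝔤) / B²(𝔤; 𝔤)`. -/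
abbrev H2 (G : LieSuperalgebra K L) : Type _ := G.Z2 ⧸ G.B2.comap G.Z2.subtype

/-- The cohomology class of a 2-cocycle. -/
def cls (G : LieSuperalgebra K L) (c : L →ₗ[K] L →ₗ[K] L) (hc : c ∈ G.Z2) : G.H2 :=
  (G.B2.comap G.Z2.subtype).mkQ ⟨c, hc⟩

/-- Coboundaries are cocycles (`d ∘ d = 0`). -/
theorem B2_le_Z2 (G : LieSuperalgebra K L) : G.B2 ≤ G.Z2 := by
  have par : ∀ α : ZMod 2, α = 0 ∨ α = 1 := by decide
  have v0 : (0 : ZMod 2).val = 0 := rfl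
  have v1 : (1 : ZMod 2).val = 1 := rfl
  have v2 : (1 + 1 : ZMod 2).val = 0 := rfl
  have ad : ∀ (α β : ZMod 2) (x y w : L), x ∈ G.part α → y ∈ G.part β →
      G.bracket (G.bracket x y) w = G.bracket x (G.bracket y w)
        - (-1 : K) ^ (α.val * β.val) • G.bracket y (G.bracket x w) := by
    have hom : ∀ (α β γ : ZMod 2) (x y w : L), x ∈ G.part α → y ∈ G.part β → w ∈ G.part γ →
        G.bracket (G.bracket x y) w = G.bracket x (G.bracket y w)
          - (-1 : K) ^ (α.val * β.val) • G.bracket y (G.bracket x w) := by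
      intro α β γ x y w hx hy hw
      have hj := G.jacobi α β γ x y w hx hy hw
      rw [G.skew γ α w x hw hx] at hj
      rw [G.skew (α + β) γ _ w (G.bracket_mem α β x y hx hy) hw]
      rcases par α with rfl | rfl <;> rcases par β with rfl | rfl <;>
        rcases par γ with rfl | rfl <;>
        simp only [v0, v1, v2, zero_add, add_zero, mul_zero, zero_mul, mul_one, pow_zero, pow_one,
          one_smul, neg_smul, map_neg, neg_neg] at hj ⊢ <;>
        first
          | (rw [← sub_eq_zero, ← hj]; abel1)
          | (rw [← sub_eq_zero, ← neg_eq_zero, ← hj]; abel1)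
    intro α β x y w hx hy
    have hw : w ∈ G.part 0 ⊔ G.part 1 := by
      rw [G.isCompl.sup_eq_top]
      trivial
    obtain ⟨w0, h0, w1, h1, rfl⟩ := Submodule.mem_sup.1 hw
    simp only [map_add, hom α β 0 x y w0 hx hy h0, hom α β 1 x y w1 hx hy h1]
    module
  rintro c ⟨b, hb⟩
  refine ⟨fun α β x y hx hy => ?_, fun α β γ x y z hx hy hz => ?_⟩
  · rw [hb α β x y hx hy, hb β α y x hy hx, d1, d1, G.skew α β x y hx hy]
    rcases par α with rfl | rfl <;> rcases par β with rfl | rfl <;>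
      simp only [v0, v1, mul_zero, zero_mul, mul_one, pow_zero, pow_one, one_smul, neg_smul,
        map_neg, neg_neg] <;> abel
  · have hxy := G.bracket_mem α β x y hx hy
    have hxz := G.bracket_mem α γ x z hx hz
    have hyz := G.bracket_mem β γ y z hy hz
    have e := congrArg b (ad α β x y z hx hy)
    have e1 := congrArg b (G.skew _ _ _ _ hxz hy)
    have e2 := congrArg b (G.skew _ _ _ _ hyz hx)
    simp only [d2, hb _ _ _ _ hxy hz, hb _ _ _ _ hxz hy, hb _ _ _ _ hyz hx, hb _ _ _ _ hx hy,
      hb _ _ _ _ hx hz, hb _ _ _ _ hy hz, d1, map_add, map_sub, map_smul, map_neg] at e e1 e2 ⊢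
    rw [e, e1, e2, ad α β x y _ hx hy, ad α γ x z _ hx hz, ad β γ y z _ hy hz]
    rcases par α with rfl | rfl <;> rcases par β with rfl | rfl <;>
      rcases par γ with rfl | rfl <;>
      simp only [v0, v1, v2, zero_add, add_zero, mul_zero, zero_mul, mul_one, pow_zero, pow_one,
        one_smul, neg_smul, map_neg, neg_neg] <;> module

/-- A bilinear map `𝔤 × 𝔤 → 𝔤` is even if it respects parities. -/
def IsEven (G : LieSuperalgebra K L) (c : L →ₗ[K] L →ₗ[K] L) : Prop :=
  ∀ (α β : ZMod 2) (x y : L), x ∈ G.part α → y ∈ G.part β → c x y ∈ G.part (α + β)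

end LieSuperalgebra

/-- Labels of the basis `X₁, …, Xₙ, T₁, T₂, T₃, Y₁, …, Yₘ` of `SL^{n,m}`. The labels are
shifted by one: `X i` stands for `X_{i+1}`, and similarly for `T` and `Y`. -/
inductive SLIndex (n m : ℕ) : Type
  | X (i : Fin n) : SLIndex n m
  | T (l : Fin 3) : SLIndex n m
  | Y (j : Fin m) : SLIndex n m
  deriving DecidableEq, Fintype

/-- The underlying vector space of `SL^{n,m}`, with its standard basis labelled by
`SLIndex n m`. -/
abbrev SLSpace (K : Type*) (n m : ℕ) : Type _ := SLIndex n m → K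

namespace SLSpace

variable (K : Type*) [Field K] (n m : ℕ)

/-- The basis vector `X_k` for `1 ≤ k ≤ n` (and `0` for other `k`). -/
def X (k : ℕ) : SLSpace K n m
  | .X i => if i.val + 1 = k then 1 else 0
  | .T _ => 0
  | .Y _ => 0

/-- The basis vector `T_{l+1}`. -/
def T (l : Fin 3) : SLSpace K n m
  | .X _ => 0
  | .T l' => if l' = l then 1 else 0
  | .Y _ => 0

/-- The basis vector `Y_k` for `1 ≤ k ≤ m` (and `0` for other `k`). -/
def Y (k : ℕ) : SLSpace K n m
  | .X _ => 0
  | .T _ => 0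
  | .Y j => if j.val + 1 = k then 1 else 0

variable {K n m} in
/-- The bilinear map with prescribed values on pairs of standard basis vectors. -/
noncomputable def bilin (f : SLIndex n m → SLIndex n m → SLSpace K n m) :
    SLSpace K n m →ₗ[K] SLSpace K n m →ₗ[K] SLSpace K n m :=
  (Pi.basisFun K (SLIndex n m)).constr K
    (fun a => (Pi.basisFun K (SLIndex n m)).constr K (f a))

/-- The defining brackets of `SL^{n,m}`:
`[X₁, X_i] = X_{i+1}` for `2 ≤ i ≤ n - 1`, `[X₁, Y_j] = Y_{j+1}` for `1 ≤ j ≤ m - 1`,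
`[T₁, X_i] = i X_i`, `[T₁, Y_j] = j Y_j`, `[T₂, X_i] = X_i` for `2 ≤ i`, `[T₃, Y_j] = Y_j`. -/
def halfTable : SLIndex n m → SLIndex n m → SLSpace K n m
  | .X i, .X i' =>
      if i.val + 1 = 1 ∧ 2 ≤ i'.val + 1 ∧ (i'.val + 1) + 1 ≤ n then X K n m ((i'.val + 1) + 1)
      else 0
  | .X i, .Y j =>
      if i.val + 1 = 1 ∧ (j.val + 1) + 1 ≤ m then Y K n m ((j.val + 1) + 1) else 0
  | .T l, .X i =>
      if l = 0 then ((i.val + 1 : ℕ) : K) • X K n m (i.val + 1)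
      else if l = 1 ∧ 2 ≤ i.val + 1 then X K n m (i.val + 1)
      else 0
  | .T l, .Y j =>
      if l = 0 then ((j.val + 1 : ℕ) : K) • Y K n m (j.val + 1)
      else if l = 2 then Y K n m (j.val + 1)
      else 0
  | _, _ => 0

/-- The bracket of `SL^{n,m}`, obtained from the defining brackets by antisymmetry (no defining
bracket has two odd arguments, so super-skew-symmetry is antisymmetry here). -/
noncomputable def bracket : SLSpace K n m →ₗ[K] SLSpace K n m →ₗ[K] SLSpace K n m :=
  bilin (fun a b => halfTable K n m a b - halfTable K n m b a)

variable {n m} in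
/-- Parity of the basis vectors: `X_i` and `T_l` are even, `Y_j` is odd. -/
def parity : SLIndex n m → ZMod 2
  | .X _ => 0
  | .T _ => 0
  | .Y _ => 1

/-- The homogeneous component of parity `α`: the span of the basis vectors of parity `α`. -/
def part (α : ZMod 2) : Submodule K (SLSpace K n m) where
  carrier := {v | ∀ a, parity a ≠ α → v a = 0}
  add_mem' := by
    intro u v hu hv a ha
    simp [hu a ha, hv a ha]
  zero_mem' := by
    intro a _
    rfl
  smul_mem' := by
    intro r u hu a ha
    simp [hu a ha]

variable {n m} in
/-- The `ℤ`-grading of `SL^{n,m}`: `deg X_r = r`, `deg Y_s = n + s`, `deg T_l = 0`. -/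
def deg : SLIndex n m → ℤ
  | .X i => (i.val : ℤ) + 1
  | .T _ => 0
  | .Y j => (n : ℤ) + ((j.val : ℤ) + 1)

variable {K n m} in
/-- The bilinear map `c` is homogeneous of degree `d` for the `ℤ`-grading of `SL^{n,m}`. -/
def HasDegree (c : SLSpace K n m →ₗ[K] SLSpace K n m →ₗ[K] SLSpace K n m) (d : ℤ) : Prop :=
  ∀ a b e : SLIndex n m, c (Pi.single a 1) (Pi.single b 1) e ≠ 0 → deg e = deg a + deg b + d

/-- The bilinear map `c₁` with `c₁(X₁, Y_p) = Y₁ = -c₁(Y_p, X₁)` and zero on all other pairs of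
basis vectors. -/
noncomputable def c1 (p : ℕ) : SLSpace K n m →ₗ[K] SLSpace K n m →ₗ[K] SLSpace K n m :=
  bilin fun
    | .X i, .Y j => if i.val + 1 = 1 ∧ j.val + 1 = p then Y K n m 1 else 0
    | .Y j, .X i => if i.val + 1 = 1 ∧ j.val + 1 = p then -Y K n m 1 else 0
    | _, _ => 0

/-- The bilinear map `c₂` with `c₂(X₁, X_{p+1}) = X₂ = -c₂(X_{p+1}, X₁)` and zero on all other
pairs of basis vectors. -/
noncomputable def c2 (p : ℕ) : SLSpace K n m →ₗ[K] SLSpace K n m →ₗ[K] SLSpace K n m :=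
  bilin fun
    | .X i, .X i' =>
        if i.val + 1 = 1 ∧ i'.val + 1 = p + 1 then X K n m 2
        else if i.val + 1 = p + 1 ∧ i'.val + 1 = 1 then -X K n m 2
        else 0
    | _, _ => 0

section Facts

variable {K n m}

theorem bilin_single (f : SLIndex n m → SLIndex n m → SLSpace K n m) (a b : SLIndex n m) :
    bilin f (Pi.single a 1) (Pi.single b 1) = f a b := by
  have h := fun c : SLIndex n m => Pi.basisFun_apply K (SLIndex n m) c
  rw [← h, ← h, bilin, Module.Basis.constr_basis, Module.Basis.constr_basis]

theorem bilin_apply (f : SLIndex n m → SLIndex n m → SLSpace K n m) (u v : SLSpace K n m) :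
    bilin f u v = ∑ a, ∑ b, (u a * v b) • f a b := by
  simp only [bilin, Module.Basis.constr_apply_fintype, LinearMap.sum_apply, LinearMap.smul_apply,
    Pi.basisFun_equivFun, LinearEquiv.refl_apply, Finset.smul_sum, smul_smul]

theorem single_X (i : Fin n) : (Pi.single (.X i) 1 : SLSpace K n m) = X K n m (i.val + 1) := by
  funext a
  cases a <;> simp [X, Pi.single_apply, Fin.ext_iff]

theorem single_T (l : Fin 3) : (Pi.single (.T l) 1 : SLSpace K n m) = T K n m l := by
  funext a
  cases a <;> simp [T, Pi.single_apply]

theorem single_Y (j : Fin m) : (Pi.single (.Y j) 1 : SLSpace K n m) = Y K n m (j.val + 1) := by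
  funext a
  cases a <;> simp [Y, Pi.single_apply, Fin.ext_iff]

theorem X_eq_zero {k : ℕ} (h : k = 0 ∨ n < k) : X K n m k = 0 := by
  funext a
  rcases a with i | l | j <;> simp [X]
  have := i.isLt
  omega

theorem Y_eq_zero {k : ℕ} (h : k = 0 ∨ m < k) : Y K n m k = 0 := by
  funext a
  rcases a with i | l | j <;> simp [Y]
  have := j.isLt
  omega

/-- Weight of `X_k` under `T_{l+1}`. -/
def wX (K : Type*) [Field K] (l : Fin 3) (k : ℕ) : K :=
  if l = 0 then (k : K) else if l = 1 ∧ 2 ≤ k then 1 else 0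

/-- Weight of `Y_k` under `T_{l+1}`. -/
def wY (K : Type*) [Field K] (l : Fin 3) (k : ℕ) : K :=
  if l = 0 then (k : K) else if l = 2 then 1 else 0

theorem X_cases (k : ℕ) : X K n m k = 0 ∧ (k = 0 ∨ n < k) ∨
    ∃ i : Fin n, i.val + 1 = k ∧ X K n m k = Pi.single (.X i) 1 := by
  by_cases h : k = 0 ∨ n < k
  · exact .inl ⟨X_eq_zero h, h⟩
  · refine .inr ⟨⟨k - 1, by omega⟩, by simp; omega, ?_⟩
    rw [single_X]
    congr 1
    simp
    omega

theorem Y_cases (k : ℕ) : Y K n m k = 0 ∧ (k = 0 ∨ m < k) ∨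
    ∃ j : Fin m, j.val + 1 = k ∧ Y K n m k = Pi.single (.Y j) 1 := by
  by_cases h : k = 0 ∨ m < k
  · exact .inl ⟨Y_eq_zero h, h⟩
  · refine .inr ⟨⟨k - 1, by omega⟩, by simp; omega, ?_⟩
    rw [single_Y]
    congr 1
    simp
    omega

theorem bracket_neg (u v : SLSpace K n m) : bracket K n m u v = -bracket K n m v u := by
  have h : bracket K n m = -(bracket K n m).flip := by
    refine (Pi.basisFun K _).ext fun a => (Pi.basisFun K _).ext fun b => ?_
    simp only [Pi.basisFun_apply, LinearMap.neg_apply, LinearMap.flip_apply, bracket,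
      bilin_single, neg_sub]
  conv_lhs => rw [h]
  rfl

theorem bracket_X_X (k k' : ℕ) : bracket K n m (X K n m k) (X K n m k') =
    if k = 1 ∧ 2 ≤ k' then X K n m (k' + 1)
    else if k' = 1 ∧ 2 ≤ k then -X K n m (k + 1) else 0 := by
  rcases X_cases (K := K) (m := m) (n := n) k with ⟨h, hk⟩ | ⟨i, hi, h⟩ <;>
  rcases X_cases (K := K) (m := m) (n := n) k' with ⟨h', hk'⟩ | ⟨i', hi', h'⟩ <;> rw [h, h']
  · simp only [map_zero]
    split_ifs
    · rw [X_eq_zero (by omega)]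
    · rw [X_eq_zero (by omega), neg_zero]
    · rfl
  · have := i'.isLt
    simp only [map_zero, LinearMap.zero_apply]
    split_ifs
    · omega
    · rw [X_eq_zero (by omega), neg_zero]
    · rfl
  · have := i.isLt
    simp only [map_zero]
    split_ifs
    · rw [X_eq_zero (by omega)]
    · omega
    · rfl
  · have hlt := i.isLt
    have hlt' := i'.isLt
    rw [bracket, bilin_single]
    simp only [halfTable, hi, hi']
    have e1 : (if k = 1 ∧ 2 ≤ k' ∧ k' + 1 ≤ n then X K n m (k' + 1) else 0)
        = if k = 1 ∧ 2 ≤ k' then X K n m (k' + 1) else 0 := by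
      by_cases hn : k' + 1 ≤ n
      · simp [hn]
      · rw [X_eq_zero (by omega)]; simp
    have e2 : (if k' = 1 ∧ 2 ≤ k ∧ k + 1 ≤ n then X K n m (k + 1) else 0)
        = if k' = 1 ∧ 2 ≤ k then X K n m (k + 1) else 0 := by
      by_cases hn : k + 1 ≤ n
      · simp [hn]
      · rw [X_eq_zero (k := k + 1) (by omega)]; simp
    rw [e1, e2]
    by_cases c1 : k = 1 ∧ 2 ≤ k'
    · rw [if_pos c1, if_pos c1, if_neg (by omega), sub_zero]
    · rw [if_neg c1, if_neg c1]
      split_ifs <;> simp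

theorem bracket_X_Y (k k' : ℕ) : bracket K n m (X K n m k) (Y K n m k') =
    if k = 1 ∧ 1 ≤ k' ∧ 1 ≤ n then Y K n m (k' + 1) else 0 := by
  rcases X_cases (K := K) (m := m) (n := n) k with ⟨h, hk⟩ | ⟨i, hi, h⟩ <;>
  rcases Y_cases (K := K) (m := m) (n := n) k' with ⟨h', hk'⟩ | ⟨i', hi', h'⟩ <;> rw [h, h']
  · simp only [map_zero]
    rw [if_neg (by omega)]
  · simp only [map_zero, LinearMap.zero_apply]
    rw [if_neg (by omega)]
  · simp only [map_zero]
    split_ifs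
    · rw [Y_eq_zero (by omega)]
    · rfl
  · have hlt := i.isLt
    have hlt' := i'.isLt
    rw [bracket, bilin_single]
    simp only [halfTable, hi, hi', sub_zero]
    by_cases hn : k' + 1 ≤ m
    · by_cases hk : k = 1
      · rw [if_pos (by omega), if_pos (by omega)]
      · rw [if_neg (by omega), if_neg (by omega)]
    · rw [Y_eq_zero (by omega)]; simp

theorem bracket_Y_Y (k k' : ℕ) : bracket K n m (Y K n m k) (Y K n m k') = 0 := by
  rcases Y_cases (K := K) (m := m) (n := n) k with ⟨h, hk⟩ | ⟨i, hi, h⟩ <;>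
  rcases Y_cases (K := K) (m := m) (n := n) k' with ⟨h', hk'⟩ | ⟨i', hi', h'⟩ <;> rw [h, h'] <;>
    simp [bracket, bilin_single, halfTable]

theorem bracket_T_T (l l' : Fin 3) : bracket K n m (T K n m l) (T K n m l') = 0 := by
  rw [← single_T, ← single_T, bracket, bilin_single]
  simp [halfTable]

theorem bracket_T_X (l : Fin 3) (k : ℕ) : bracket K n m (T K n m l) (X K n m k) =
    wX K l k • X K n m k := by
  rcases X_cases (K := K) (m := m) (n := n) k with ⟨h, hk⟩ | ⟨i, hi, h⟩
  · simp [h]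
  · rw [h, ← single_T, bracket, bilin_single]
    simp only [halfTable, hi, wX, sub_zero, h]
    split_ifs <;> simp

theorem bracket_T_Y (l : Fin 3) (k : ℕ) : bracket K n m (T K n m l) (Y K n m k) =
    wY K l k • Y K n m k := by
  rcases Y_cases (K := K) (m := m) (n := n) k with ⟨h, hk⟩ | ⟨i, hi, h⟩
  · simp [h]
  · rw [h, ← single_T, bracket, bilin_single]
    simp only [halfTable, hi, wY, sub_zero, h]
    split_ifs <;> simp

theorem bracket_X_T (l : Fin 3) (k : ℕ) : bracket K n m (X K n m k) (T K n m l) =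
    -(wX K l k • X K n m k) := by
  rw [bracket_neg, bracket_T_X]

theorem bracket_Y_T (l : Fin 3) (k : ℕ) : bracket K n m (Y K n m k) (T K n m l) =
    -(wY K l k • Y K n m k) := by
  rw [bracket_neg, bracket_T_Y]

theorem wX_succ (l : Fin 3) (k : ℕ) :
    wX K l (k + 1 + 1 + 1) = wX K l 1 + wX K l (k + 1 + 1) := by
  simp only [wX]
  split_ifs <;> first | omega | (push_cast; ring)

theorem wY_succ (l : Fin 3) (k : ℕ) : wY K l (k + 1 + 1) = wX K l 1 + wY K l (k + 1) := by
  simp only [wX, wY]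
  split_ifs <;> first | omega | (push_cast; ring)

theorem jacobi_of_basis {ι L : Type*} [AddCommGroup L] [Module K L] (e : Module.Basis ι K L)
    (B : L →ₗ[K] L →ₗ[K] L)
    (h : ∀ i j k, B (e i) (B (e j) (e k)) + B (e j) (B (e k) (e i)) + B (e k) (B (e i) (e j)) = 0)
    (u v w : L) : B u (B v w) + B v (B w u) + B w (B u v) = 0 := by
  have lin : ∀ v w : L, (∀ i, B (e i) (B v w) + B v (B w (e i)) + B w (B (e i) v) = 0) →
      ∀ u : L, B u (B v w) + B v (B w u) + B w (B u v) = 0 := by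
    intro v w h u
    have E : B.flip (B v w) + B v ∘ₗ B w + B w ∘ₗ B.flip v = 0 := by
      refine e.ext fun a => ?_
      simpa using h a
    simpa using LinearMap.congr_fun E u
  have cyc : ∀ x y z : L, x + y + z = 0 → y + z + x = 0 := by
    intro x y z h
    rw [← h]
    abel
  have h1 : ∀ u j k, B u (B (e j) (e k)) + B (e j) (B (e k) u) + B (e k) (B u (e j)) = 0 :=
    fun u j k => lin _ _ (fun i => h i j k) u
  have h2 : ∀ u v k, B u (B v (e k)) + B v (B (e k) u) + B (e k) (B u v) = 0 :=
    fun u v k => cyc _ _ _ (cyc _ _ _ (lin (e k) u (fun j => cyc _ _ _ (h1 u j k)) v))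
  exact cyc _ _ _ (lin u v (fun k => cyc _ _ _ (cyc _ _ _ (h2 u v k))) w)

theorem bracket_jacobi (u v w : SLSpace K n m) :
    bracket K n m u (bracket K n m v w) + bracket K n m v (bracket K n m w u)
      + bracket K n m w (bracket K n m u v) = 0 := by
  have b11 : bracket K n m (X K n m 1) (X K n m 1) = 0 := by
    rw [bracket_X_X, if_neg (by omega), if_neg (by omega)]
  have b1k : ∀ k, bracket K n m (X K n m 1) (X K n m (k + 1 + 1)) = X K n m (k + 1 + 1 + 1) := by
    intro k
    rw [bracket_X_X, if_pos (by omega)]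
  have bk1 : ∀ k, bracket K n m (X K n m (k + 1 + 1)) (X K n m 1) = -X K n m (k + 1 + 1 + 1) := by
    intro k
    rw [bracket_neg, b1k]
  have bkk : ∀ k k', bracket K n m (X K n m (k + 1 + 1)) (X K n m (k' + 1 + 1)) = 0 := by
    intro k k'
    rw [bracket_X_X, if_neg (by omega), if_neg (by omega)]
  have bkY : ∀ k k', bracket K n m (X K n m (k + 1 + 1)) (Y K n m k') = 0 := by
    intro k k'
    rw [bracket_X_Y, if_neg (by omega)]
  have bYk : ∀ k k', bracket K n m (Y K n m k') (X K n m (k + 1 + 1)) = 0 := by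
    intro k k'
    rw [bracket_neg, bkY, neg_zero]
  have b1Y : 0 < n → ∀ k, bracket K n m (X K n m 1) (Y K n m (k + 1)) = Y K n m (k + 1 + 1) := by
    intro hn k
    rw [bracket_X_Y, if_pos (by omega)]
  have bY1 : 0 < n → ∀ k, bracket K n m (Y K n m (k + 1)) (X K n m 1) = -Y K n m (k + 1 + 1) := by
    intro hn k
    rw [bracket_neg, b1Y hn]
  refine jacobi_of_basis (Pi.basisFun K _) _ (fun a b c => ?_) u v w
  simp only [Pi.basisFun_apply]
  rcases a with ⟨_ | i, hi⟩ | l | j <;> rcases b with ⟨_ | i', hi'⟩ | l' | j' <;>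
    rcases c with ⟨_ | i'', hi''⟩ | l'' | j'' <;>
  simp only [single_X, single_T, single_Y, zero_add, *,
    bracket_X_T, bracket_T_X, bracket_T_T, bracket_T_Y, bracket_Y_T, bracket_Y_Y, map_neg,
    map_smul, map_zero, wX_succ, wY_succ, smul_zero, neg_zero, add_zero] <;>
  module

theorem bracket_odd (u v : SLSpace K n m) (hu : u ∈ part K n m 1) (hv : v ∈ part K n m 1) :
    bracket K n m u v = 0 := by
  have h : ∀ u : SLSpace K n m, u ∈ part K n m 1 →
      u = ∑ j : Fin m, u (.Y j) • Y K n m (j.val + 1) := by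
    intro u hu
    funext a
    rcases a with i | l | j
    · rw [hu _ (by simp [parity])]
      simp [Y]
    · rw [hu _ (by simp [parity])]
      simp [Y]
    · simp [Y, Fin.val_inj]
  rw [h u hu, h v hv]
  simp [bracket_Y_Y]

theorem neg_one_pow_val (x : SLSpace K n m) (α β : ZMod 2) (h : α = 0 ∨ β = 0) :
    (-1 : K) ^ (α.val * β.val) • x = x := by
  rcases h with rfl | rfl <;> simp

theorem eq_one_of_ne_zero {α : ZMod 2} (h : α ≠ 0) : α = 1 := by
  revert α
  decide

theorem bracket_mem (α β : ZMod 2) (x y : SLSpace K n m) (hx : x ∈ part K n m α)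
    (hy : y ∈ part K n m β) : bracket K n m x y ∈ part K n m (α + β) := by
  have key : ∀ a b c : SLIndex n m, parity c ≠ parity a + parity b →
      halfTable K n m a b c = 0 := by
    intro a b c h
    rcases a with i | l | j <;> rcases b with i' | l' | j' <;> rcases c with i'' | l'' | j'' <;>
      simp only [parity, halfTable] at h ⊢ <;>
      first
        | exact absurd (by decide) h
        | rfl
        | (split_ifs <;> simp [X, Y])
  intro c hc
  rw [bracket, bilin_apply]
  simp only [Finset.sum_apply, Pi.smul_apply, Pi.sub_apply]
  refine Finset.sum_eq_zero fun a _ => Finset.sum_eq_zero fun b _ => ?_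
  by_cases ha : parity a = α
  · by_cases hb : parity b = β
    · subst ha hb
      rw [key a b c hc, key b a c (by rwa [add_comm]), sub_zero, smul_zero]
    · rw [hy b hb, mul_zero, zero_smul]
  · rw [hx a ha, zero_mul, zero_smul]

theorem isCompl_part : IsCompl (part K n m 0) (part K n m 1) := by
  constructor
  · rw [Submodule.disjoint_def]
    intro v h0 h1
    funext a
    by_cases ha : parity a = 0
    · exact h1 a (by rw [ha]; decide)
    · exact h0 a ha
  · rw [codisjoint_iff, eq_top_iff]
    intro v _
    rw [Submodule.mem_sup]
    refine ⟨fun a => if parity a = 0 then v a else 0, fun a ha => if_neg ha,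
      fun a => if parity a = 0 then 0 else v a, fun a ha => ?_, ?_⟩
    · by_cases h : parity a = 0
      · exact if_pos h
      · exact absurd (eq_one_of_ne_zero h) ha
    · funext a
      by_cases h : parity a = 0 <;> simp [h]

end Facts

end SLSpace

/-- The solvable Lie superalgebra `SL^{n,m}` over `K`, with basis
`X₁, …, Xₙ, T₁, T₂, T₃ | Y₁, …, Yₘ`. -/
noncomputable def SL (K : Type*) [Field K] (n m : ℕ) : LieSuperalgebra K (SLSpace K n m) where
  part := SLSpace.part K n m
  isCompl := SLSpace.isCompl_part
  bracket := SLSpace.bracket K n m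
  bracket_mem := SLSpace.bracket_mem
  skew := by
    intro α β x y hx hy
    by_cases h : α = 0 ∨ β = 0
    · rw [SLSpace.neg_one_pow_val _ _ _ h, SLSpace.bracket_neg]
    · obtain ⟨hα, hβ⟩ := not_or.1 h
      obtain rfl := SLSpace.eq_one_of_ne_zero hα
      obtain rfl := SLSpace.eq_one_of_ne_zero hβ
      simp [SLSpace.bracket_odd x y hx hy, SLSpace.bracket_odd y x hy hx]
  jacobi := by
    intro α β γ x y z hx hy hz
    have hj := SLSpace.bracket_jacobi x y z
    have hxy := SLSpace.bracket_mem α β x y hx hy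
    have hyz := SLSpace.bracket_mem β γ y z hy hz
    have hzx := SLSpace.bracket_mem γ α z x hz hx
    have odd := SLSpace.bracket_odd (K := K) (n := n) (m := m)
    by_cases hα : α = 0 <;> by_cases hβ : β = 0 <;> by_cases hγ : γ = 0 <;>
      (try obtain rfl := SLSpace.eq_one_of_ne_zero hα) <;>
      (try obtain rfl := SLSpace.eq_one_of_ne_zero hβ) <;>
      (try obtain rfl := SLSpace.eq_one_of_ne_zero hγ) <;>
      (try subst hα) <;> (try subst hβ) <;> (try subst hγ)
    · simpa using hj
    · simpa using hj
    · simpa using hj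
    · rw [odd y z hy hz, odd y _ hy hzx, odd z _ hz hxy]
      simp
    · simpa using hj
    · rw [odd z x hz hx, odd x _ hx hyz, odd z _ hz hxy]
      simp
    · rw [odd x y hx hy, odd x _ hx hyz, odd y _ hy hzx]
      simp
    · rw [odd x y hx hy, odd y z hy hz, odd z x hz hx]
      simp

/-! The torus spanned by `T₁, T₂, T₃` acts diagonally on the algebra, with weights in the prime
field. By Cartan's formula its Lie derivatives send cocycles to coboundaries (`lieDeriv_mem_B2`). On
a matrix coefficient of weight `w` the operator `1 - (lieDeriv t)^(p-1)` is multiplication by `1 -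
w^(p-1)`, which is `1` for `w = 0` and `0` for every other `w` in the prime field. It therefore
projects a cocycle to weight zero without changing its class (`exists_isWeightZero`).

For `n ≤ p + 1` and `m ≤ p` distinct basis vectors of the nilradical have distinct weights, none of
them zero, so a weight-zero cocycle is nearly determined by scalars. It vanishes on all pairs from
the nilradical except those containing `X₁`. It sends `(X₁, X_k)` to a multiple of `X_{k+1}` and
`(X₁, Y_k)` to a multiple of `Y_{k+1}`. Reduction of weights mod `p` adds two wrap-arounds: `(X₁,
X_{p+1})` goes to a multiple of `X₂` and `(X₁, Y_p)` to a multiple of `Y₁`. These are the maps `c₂`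
and `c₁`.

All the rest is exact. Contraction with a torus element is a diagonal derivation of the nilradical,
hence inner by a torus element (`IsWeightZero.exists_inner`), and the scalars at `(X₁, X_k)` and
`(X₁, Y_k)` telescope into a diagonal 1-cochain (`IsWeightZero.exists_sub_mem_B2`).

Conversely, `c₁` and `c₂` are decomposable, of the form `φ ∧ ψ ⊗ w`, and are cocycles because the
weights of `φ`, `ψ` and `w` balance mod `p` (`wedge_mem_Z2`). At `m = p` no coboundary has a
`Y₁`-component at `(X₁, Y_p)`, and at `n = p + 1` none has an `X₂`-component at `(X₁, X_{p+1})`.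
This gives independence. -/

namespace LieSuperalgebra

/-! ### Cartan's formula and decomposable cocycles -/

variable {K : Type*} [Field K] {L : Type*} [AddCommGroup L] [Module K L]

/-- The Lie derivative of a bilinear map `c` along an even element `t`:
`(x, y) ↦ [t, c(x, y)] - c([t, x], y) - c(x, [t, y])`. -/
def lieDeriv (G : LieSuperalgebra K L) (t : L) (c : L →ₗ[K] L →ₗ[K] L) : L →ₗ[K] L →ₗ[K] L :=
  c.compr₂ (G.bracket t) - c.comp (G.bracket t) - c.compl₂ (G.bracket t)

theorem lieDeriv_apply (G : LieSuperalgebra K L) (t : L) (c : L →ₗ[K] L →ₗ[K] L) (x y : L) :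
    G.lieDeriv t c x y = G.bracket t (c x y) - c (G.bracket t x) y - c x (G.bracket t y) := by
  simp [lieDeriv]

/-- Cartan's formula for cocycles: the Lie derivative of a cocycle `c` along `t` is the
differential of `-c(t, ·)`. -/
theorem lieDeriv_apply_of_mem_Z2 (G : LieSuperalgebra K L) {t : L} (ht : t ∈ G.part 0)
    {c : L →ₗ[K] L →ₗ[K] L} (hc : c ∈ G.Z2) (α β : ZMod 2) {x y : L} (hx : x ∈ G.part α)
    (hy : y ∈ G.part β) : G.lieDeriv t c x y = -G.d1 (c t) α β x y := by
  have par : ∀ α : ZMod 2, α = 0 ∨ α = 1 := by decide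
  have v0 : (0 : ZMod 2).val = 0 := rfl
  have v1 : (1 : ZMod 2).val = 1 := rfl
  have hd := hc.2 0 α β t x y ht hx hy
  have hty := G.bracket_mem 0 β t y ht hy
  rw [zero_add] at hty
  have e1 := hc.1 β α _ _ hty hx
  have e2 := hc.1 (α + β) 0 _ _ (G.bracket_mem α β x y hx hy) ht
  rw [lieDeriv_apply, ← sub_eq_zero, d1, ← neg_eq_zero, ← hd, d2, e1, e2]
  rcases par α with rfl | rfl <;> rcases par β with rfl | rfl <;>
    simp only [v0, v1, zero_add, add_zero, mul_zero, zero_mul, mul_one, pow_zero, pow_one,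
      one_smul, neg_smul, map_neg, neg_neg] <;> abel

theorem lieDeriv_mem_B2 (G : LieSuperalgebra K L) {t : L} (ht : t ∈ G.part 0)
    {c : L →ₗ[K] L →ₗ[K] L} (hc : c ∈ G.Z2) : G.lieDeriv t c ∈ G.B2 := by
  refine ⟨-c t, fun α β x y hx hy => ?_⟩
  rw [G.lieDeriv_apply_of_mem_Z2 ht hc α β hx hy]
  simp only [d1, LinearMap.neg_apply, map_neg]
  module

theorem lieDeriv_iterate_mem_B2 (G : LieSuperalgebra K L) {t : L} (ht : t ∈ G.part 0)
    {c : L →ₗ[K] L →ₗ[K] L} (hc : c ∈ G.Z2) (k : ℕ) : (G.lieDeriv t)^[k + 1] c ∈ G.B2 := by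
  induction k with
  | zero => exact G.lieDeriv_mem_B2 ht hc
  | succ k ih =>
    rw [Function.iterate_succ_apply']
    exact G.lieDeriv_mem_B2 ht (G.B2_le_Z2 ih)

/-- A skew-symmetric cochain of the form `(x, y) ↦ (φ(x)ψ(y) - ψ(x)φ(y)) w`. -/
def wedge (φ ψ : L →ₗ[K] K) (w : L) : L →ₗ[K] L →ₗ[K] L :=
  (LinearMap.smulRightₗ (R := K) (M := L) (M₂ := L)).flip w ∘ₗ
    (φ.smulRight ψ - ψ.smulRight φ)

theorem wedge_apply (φ ψ : L →ₗ[K] K) (w x y : L) :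
    wedge φ ψ w x y = (φ x * ψ y - ψ x * φ y) • w := by
  simp [wedge, sub_smul, mul_smul]

/-- In terms of forms, `bφ` reads `dφ = τ ∧ φ`, `bψ` reads `dψ = τ' ∧ ψ + φ ∧ χ`, and `bw` says that
`w` has weight `τ + τ'` up to `φ ⊗ w'`. The weight terms cancel, and the corrections by `χ` and `w'`
die because they come with `φ ∧ φ = 0`. -/
theorem wedge_mem_Z2 (G : LieSuperalgebra K L) (φ ψ χ τ τ' : L →ₗ[K] K) (w w' : L)
    (hφ : ∀ x ∈ G.part 1, φ x = 0) (hτ : ∀ x ∈ G.part 1, τ x = 0)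
    (hτ' : ∀ x ∈ G.part 1, τ' x = 0)
    (bφ : ∀ x y, φ (G.bracket x y) = τ x * φ y - φ x * τ y)
    (bψ : ∀ x y, ψ (G.bracket x y) = τ' x * ψ y - ψ x * τ' y + (φ x * χ y - χ x * φ y))
    (bw : ∀ x, G.bracket x w = (τ x + τ' x) • w + φ x • w') : wedge φ ψ w ∈ G.Z2 := by
  have par : ∀ α : ZMod 2, α = 0 ∨ α = 1 := by decide
  have v0 : (0 : ZMod 2).val = 0 := rfl
  have v1 : (1 : ZMod 2).val = 1 := rfl
  refine ⟨fun α β x y hx hy => ?_, fun α β γ x y z hx hy hz => ?_⟩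
  · simp only [wedge_apply]
    rcases par α with rfl | rfl <;> rcases par β with rfl | rfl
    on_goal 4 => simp [hφ x hx, hφ y hy]
    all_goals
      simp only [v0, v1, mul_zero, zero_mul, pow_zero, one_smul]
      module
  · simp only [d2, wedge_apply, bφ, bψ, map_smul, bw]
    rcases par α with rfl | rfl <;> rcases par β with rfl | rfl <;> rcases par γ with rfl | rfl
    -- These four goals have at least two odd arguments and need the vanishing of the even forms
    -- there. In the other four every sign is `+1` and the identity is the ungraded one.
    on_goal 8 => simp [hφ _ hx, hφ _ hy, hφ _ hz]
    on_goal 7 => simp [hφ _ hx, hφ _ hy, hτ _ hx, hτ _ hy, hτ' _ hx, hτ' _ hy]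
    on_goal 6 => simp [hφ _ hx, hφ _ hz, hτ _ hx, hτ _ hz, hτ' _ hx, hτ' _ hz]
    on_goal 4 => simp [hφ _ hz, hφ _ hy, hτ _ hz, hτ _ hy, hτ' _ hz, hτ' _ hy]
    all_goals
      simp only [v0, v1, zero_add, add_zero, mul_zero, zero_mul, pow_zero, one_smul]
      module

end LieSuperalgebra

/-! ### Torus weights and reduction to weight zero -/

namespace SLSpace

variable {K : Type*} [Field K] {n m : ℕ}

theorem part_induction {α : ZMod 2} {P : SLSpace K n m → Prop} (zero : P 0)
    (add : ∀ x y, P x → P y → P (x + y)) (smul : ∀ (r : K) x, P x → P (r • x))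
    (single : ∀ a : SLIndex n m, parity a = α → P (Pi.single a 1)) {x : SLSpace K n m}
    (hx : x ∈ part K n m α) : P x := by
  rw [pi_eq_sum_univ' x]
  refine Finset.sum_induction _ P add zero fun a _ => ?_
  by_cases ha : parity a = α
  · convert smul (x a) _ (single a ha) using 2
  · rw [hx a ha, zero_smul]
    exact zero

theorem single_mem_part (a : SLIndex n m) :
    (Pi.single a 1 : SLSpace K n m) ∈ part K n m (parity a) := by
  intro b hb
  rw [Pi.single_apply, if_neg]
  rintro rfl
  exact hb rfl

/-- A cochain whose values on pairs of basis vectors are those of a differential is a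
coboundary. -/
theorem mem_B2_of_single {c : SLSpace K n m →ₗ[K] SLSpace K n m →ₗ[K] SLSpace K n m}
    (b : SLSpace K n m →ₗ[K] SLSpace K n m)
    (h : ∀ a a' : SLIndex n m, c (Pi.single a 1) (Pi.single a' 1) =
      (SL K n m).d1 b (parity a) (parity a') (Pi.single a 1) (Pi.single a' 1)) :
    c ∈ (SL K n m).B2 := by
  refine ⟨b, fun α β x y hx hy => ?_⟩
  revert x
  refine part_induction (P := fun y => ∀ x, x ∈ (SL K n m).part α →
    c x y = (SL K n m).d1 b α β x y) ?_ ?_ ?_ ?_ hy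
  · simp [LieSuperalgebra.d1]
  · intro y y' h h' x hx
    rw [map_add, h x hx, h' x hx]
    simp only [LieSuperalgebra.d1, map_add, LinearMap.add_apply]
    module
  · intro r y h x hx
    rw [map_smul, h x hx]
    simp only [LieSuperalgebra.d1, map_smul, LinearMap.smul_apply]
    module
  · rintro a' rfl x hx
    refine part_induction (P := fun x => c x _ = (SL K n m).d1 b α _ x _) ?_ ?_ ?_ ?_ hx
    · simp [LieSuperalgebra.d1]
    · intro y y' h h'
      rw [map_add, LinearMap.add_apply, h, h']
      simp only [LieSuperalgebra.d1, map_add, LinearMap.add_apply]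
      module
    · intro r y h
      rw [map_smul, LinearMap.smul_apply, h]
      simp only [LieSuperalgebra.d1, map_smul, LinearMap.smul_apply]
      module
    · rintro a rfl
      exact h a a'

/-- The weight of a basis vector with respect to `T_{l+1}`. -/
def wt (K : Type*) [Field K] (l : Fin 3) : SLIndex n m → K
  | .X i => wX K l (i.val + 1)
  | .T _ => 0
  | .Y j => wY K l (j.val + 1)

theorem bracket_T_single (l : Fin 3) (a : SLIndex n m) :
    bracket K n m (T K n m l) (Pi.single a 1) = wt K l a • Pi.single a 1 := by
  rcases a with i | l' | j
  · rw [single_X, bracket_T_X, wt]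
  · rw [single_T, bracket_T_T, wt, zero_smul]
  · rw [single_Y, bracket_T_Y, wt]

theorem bracket_T_apply (l : Fin 3) (v : SLSpace K n m) (a : SLIndex n m) :
    bracket K n m (T K n m l) v a = wt K l a * v a := by
  have h : LinearMap.proj a ∘ₗ bracket K n m (T K n m l) = wt K l a • LinearMap.proj a := by
    refine (Pi.basisFun K _).ext fun b => ?_
    simp only [Pi.basisFun_apply, LinearMap.comp_apply, bracket_T_single, LinearMap.proj_apply,
      LinearMap.smul_apply, Pi.smul_apply, smul_eq_mul, Pi.single_apply]
    split_ifs with h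
    · rw [h]
    · simp
  exact LinearMap.congr_fun h v

theorem T_mem_part (l : Fin 3) : T K n m l ∈ part K n m 0 := by
  have h := single_mem_part (K := K) (.T l : SLIndex n m)
  rwa [single_T] at h

/-- The torus acts diagonally on the basis, hence diagonally on the matrix coefficients of bilinear
maps. -/
theorem lieDeriv_T_iterate_single (l : Fin 3) (k : ℕ)
    (c : SLSpace K n m →ₗ[K] SLSpace K n m →ₗ[K] SLSpace K n m) (a b e : SLIndex n m) :
    ((SL K n m).lieDeriv (T K n m l))^[k] c (Pi.single a 1) (Pi.single b 1) e =
      (wt K l e - wt K l a - wt K l b) ^ k * c (Pi.single a 1) (Pi.single b 1) e := by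
  induction k with
  | zero => simp
  | succ k ih =>
    have hT : (SL K n m).bracket = bracket K n m := rfl
    rw [Function.iterate_succ_apply', LieSuperalgebra.lieDeriv_apply, hT, bracket_T_single,
      bracket_T_single, map_smul, map_smul, LinearMap.smul_apply, Pi.sub_apply, Pi.sub_apply,
      bracket_T_apply, Pi.smul_apply, Pi.smul_apply, ih, smul_eq_mul, smul_eq_mul]
    ring

/-- Weights are images of natural numbers, so Frobenius fixes them. -/
theorem wt_pow_char (p : ℕ) [Fact p.Prime] [CharP K p] (l : Fin 3) (a : SLIndex n m) :
    wt K l a ^ p = wt K l a := by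
  have hp := (Fact.out : p.Prime).ne_zero
  have cast : ∀ k : ℕ, (k : K) ^ p = k := fun k => map_natCast (frobenius K p) k
  rcases a with i | l' | j
  · simp only [wt, wX]
    split_ifs
    · exact cast _
    · simp
    · simp [hp]
  · simp [wt, hp]
  · simp only [wt, wY]
    split_ifs
    · exact cast _
    · simp
    · simp [hp]

/-- The bilinear map `c` commutes with the torus spanned by `T₁, T₂, T₃`. -/
def IsWeightZero (c : SLSpace K n m →ₗ[K] SLSpace K n m →ₗ[K] SLSpace K n m) : Prop :=
  ∀ a b e : SLIndex n m, c (Pi.single a 1) (Pi.single b 1) e ≠ 0 →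
    ∀ l, wt K l e = wt K l a + wt K l b

/-- Every cocycle is cohomologous to one of weight zero. -/
theorem exists_isWeightZero (p : ℕ) [Fact p.Prime] [CharP K p]
    {c : SLSpace K n m →ₗ[K] SLSpace K n m →ₗ[K] SLSpace K n m} (hc : c ∈ (SL K n m).Z2) :
    ∃ c' ∈ (SL K n m).Z2, c - c' ∈ (SL K n m).B2 ∧ IsWeightZero c' := by
  have key : ∀ s : Finset (Fin 3), ∃ c' ∈ (SL K n m).Z2, c - c' ∈ (SL K n m).B2 ∧
      ∀ a b e, c' (Pi.single a 1) (Pi.single b 1) e ≠ 0 →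
        ∀ l ∈ s, wt K l e = wt K l a + wt K l b := by
    intro s
    induction s using Finset.induction_on with
    | empty => exact ⟨c, hc, by simp, by simp⟩
    | insert l s _ ih =>
      obtain ⟨c', hc', hb, hs⟩ := ih
      have hp := (Fact.out : p.Prime).two_le
      -- With `p = q + 2`, the iterate of order `q + 1 = p - 1` is a coboundary since `p - 1 ≥ 1`;
      -- it is subtracted from `c'`.
      obtain ⟨q, rfl⟩ : ∃ q, p = q + 2 := ⟨p - 2, by omega⟩
      have hB := (SL K n m).lieDeriv_iterate_mem_B2 (T_mem_part l) hc' q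
      refine ⟨_, sub_mem hc' ((SL K n m).B2_le_Z2 hB), ?_, fun a b e hne l' hl' => ?_⟩
      · rw [sub_sub_eq_add_sub, add_sub_right_comm]
        exact add_mem hb hB
      · rw [LinearMap.sub_apply, LinearMap.sub_apply, Pi.sub_apply,
          lieDeriv_T_iterate_single, ← one_sub_mul] at hne
        rcases Finset.mem_insert.1 hl' with rfl | hl'
        · have hw : (wt K l' e - wt K l' a - wt K l' b) ^ (q + 2) =
              wt K l' e - wt K l' a - wt K l' b := by
            rw [sub_pow_char, sub_pow_char]
            simp only [wt_pow_char]
          -- A nonzero `w` with `w ^ p = w` has `w ^ (p - 1) = 1`, so the factor `1 - w ^ (p - 1)`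
          -- would kill the coefficient.
          by_contra h
          have h0 : wt K l' e - wt K l' a - wt K l' b ≠ 0 := by
            rwa [sub_sub, sub_ne_zero]
          rw [pow_succ, mul_eq_right₀ h0] at hw
          rw [hw, sub_self, zero_mul] at hne
          exact hne rfl
        -- Subtraction only rescales coefficients, so conditions already obtained for other torus
        -- elements persist.
        · exact hs a b e (right_ne_zero_of_mul hne) l' hl'
  obtain ⟨c', hc', hb, h⟩ := key Finset.univ
  exact ⟨c', hc', hb, fun a b e hne l => h a b e hne l (Finset.mem_univ l)⟩

/-! ### Structure equations for the dual basis -/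

theorem bracket_Y_X (k k' : ℕ) : bracket K n m (Y K n m k) (X K n m k') =
    -bracket K n m (X K n m k') (Y K n m k) := bracket_neg _ _

theorem X_apply_X (k : ℕ) (i : Fin n) :
    X K n m k (.X i) = if i.val + 1 = k then 1 else 0 := rfl

theorem X_apply_T (k : ℕ) (l : Fin 3) : X K n m k (.T l) = 0 := rfl

theorem X_apply_Y (k : ℕ) (j : Fin m) : X K n m k (.Y j) = 0 := rfl

theorem Y_apply_X (k : ℕ) (i : Fin n) : Y K n m k (.X i) = 0 := rfl

theorem Y_apply_T (k : ℕ) (l : Fin 3) : Y K n m k (.T l) = 0 := rfl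

theorem Y_apply_Y (k : ℕ) (j : Fin m) :
    Y K n m k (.Y j) = if j.val + 1 = k then 1 else 0 := rfl

theorem T_apply_X (l : Fin 3) (i : Fin n) : T K n m l (.X i) = 0 := rfl

theorem T_apply_T (l l' : Fin 3) : T K n m l (.T l') = if l' = l then 1 else 0 := rfl

theorem T_apply_Y (l : Fin 3) (j : Fin m) : T K n m l (.Y j) = 0 := rfl

theorem eq_of_single {M : Type*} [AddCommGroup M] [Module K M]
    {f g : SLSpace K n m →ₗ[K] SLSpace K n m →ₗ[K] M}
    (h : ∀ a b : SLIndex n m,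
      f (Pi.single a 1) (Pi.single b 1) = g (Pi.single a 1) (Pi.single b 1)) :
    f = g :=
  (Pi.basisFun K _).ext fun a => (Pi.basisFun K _).ext fun b => by
    simpa only [Pi.basisFun_apply] using h a b

theorem smulRight_apply_apply (f g : SLSpace K n m →ₗ[K] K) (x y : SLSpace K n m) :
    f.smulRight g x y = f x * g y := rfl

theorem bracket_apply_X_one (hn : 0 < n) (x y : SLSpace K n m) :
    bracket K n m x y (.X ⟨0, hn⟩) =
      x (.T 0) * y (.X ⟨0, hn⟩) - x (.X ⟨0, hn⟩) * y (.T 0) := by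
  let φ : SLSpace K n m →ₗ[K] K := LinearMap.proj (.X ⟨0, hn⟩)
  let τ : SLSpace K n m →ₗ[K] K := LinearMap.proj (.T 0)
  have h : (bracket K n m).compr₂ φ = τ.smulRight φ - φ.smulRight τ := by
    refine eq_of_single fun a b => ?_
    simp only [LinearMap.compr₂_apply, LinearMap.sub_apply, smulRight_apply_apply, φ, τ,
      LinearMap.proj_apply]
    rcases a with i | l | j <;> rcases b with i' | l' | j' <;>
      simp only [single_X, single_T, single_Y, bracket_X_X, bracket_X_T, bracket_T_X,
        bracket_T_T, bracket_X_Y, bracket_Y_X, bracket_T_Y, bracket_Y_T, bracket_Y_Y, ite_apply,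
        Pi.neg_apply, Pi.smul_apply, Pi.zero_apply, smul_eq_mul,
        X_apply_X, X_apply_T, X_apply_Y, Y_apply_X, Y_apply_T, Y_apply_Y, T_apply_X, T_apply_T,
        T_apply_Y, wX, wY]
    all_goals (try split_ifs) <;> first | omega | (simp; done) | simp_all
  exact LinearMap.congr_fun (LinearMap.congr_fun h x) y

/-- This is the equation `dψ = τ ∧ ψ + φ ∧ χ` for the coordinate of `X_{k+1}`. The bound `2 ≤ k` is
needed because `X₂` is not a bracket of `X₁` with another `X`. -/
theorem bracket_apply_X_succ {k : ℕ} (hk : 2 ≤ k) (hn : k < n) (x y : SLSpace K n m) :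
    bracket K n m x y (.X ⟨k, hn⟩) =
      (((k : K) + 1) * x (.T 0) + x (.T 1)) * y (.X ⟨k, hn⟩)
      - x (.X ⟨k, hn⟩) * (((k : K) + 1) * y (.T 0) + y (.T 1))
      + (x (.X ⟨0, by omega⟩) * y (.X ⟨k - 1, by omega⟩)
        - x (.X ⟨k - 1, by omega⟩) * y (.X ⟨0, by omega⟩)) := by
  let φ : SLSpace K n m →ₗ[K] K := LinearMap.proj (.X ⟨0, by omega⟩)
  let χ : SLSpace K n m →ₗ[K] K := LinearMap.proj (.X ⟨k - 1, by omega⟩)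
  let ψ : SLSpace K n m →ₗ[K] K := LinearMap.proj (.X ⟨k, hn⟩)
  let τ : SLSpace K n m →ₗ[K] K := ((k : K) + 1) • LinearMap.proj (.T 0) + LinearMap.proj (.T 1)
  have h : (bracket K n m).compr₂ ψ =
      τ.smulRight ψ - ψ.smulRight τ + (φ.smulRight χ - χ.smulRight φ) := by
    refine eq_of_single fun a b => ?_
    simp only [LinearMap.compr₂_apply, LinearMap.sub_apply, LinearMap.add_apply,
      smulRight_apply_apply, φ, ψ, χ, τ, LinearMap.proj_apply, LinearMap.smul_apply]
    rcases a with i | l | j <;> rcases b with i' | l' | j' <;>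
      simp only [single_X, single_T, single_Y, bracket_X_X, bracket_X_T, bracket_T_X,
        bracket_T_T, bracket_X_Y, bracket_Y_X, bracket_T_Y, bracket_Y_T, bracket_Y_Y, ite_apply,
        Pi.neg_apply, Pi.smul_apply, Pi.zero_apply, smul_eq_mul,
        X_apply_X, X_apply_T, X_apply_Y, Y_apply_X, Y_apply_T, Y_apply_Y, T_apply_X, T_apply_T,
        T_apply_Y, wX, wY]
    all_goals (try split_ifs) <;> first | omega | (simp; done) | simp_all
  exact LinearMap.congr_fun (LinearMap.congr_fun h x) y

theorem bracket_apply_Y_succ (hn : 0 < n) {k : ℕ} (hk : 1 ≤ k) (hm : k < m)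
    (x y : SLSpace K n m) :
    bracket K n m x y (.Y ⟨k, hm⟩) =
      (((k : K) + 1) * x (.T 0) + x (.T 2)) * y (.Y ⟨k, hm⟩)
      - x (.Y ⟨k, hm⟩) * (((k : K) + 1) * y (.T 0) + y (.T 2))
      + (x (.X ⟨0, hn⟩) * y (.Y ⟨k - 1, by omega⟩)
        - x (.Y ⟨k - 1, by omega⟩) * y (.X ⟨0, hn⟩)) := by
  let φ : SLSpace K n m →ₗ[K] K := LinearMap.proj (.X ⟨0, hn⟩)
  let χ : SLSpace K n m →ₗ[K] K := LinearMap.proj (.Y ⟨k - 1, by omega⟩)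
  let ψ : SLSpace K n m →ₗ[K] K := LinearMap.proj (.Y ⟨k, hm⟩)
  let τ : SLSpace K n m →ₗ[K] K := ((k : K) + 1) • LinearMap.proj (.T 0) + LinearMap.proj (.T 2)
  have h : (bracket K n m).compr₂ ψ =
      τ.smulRight ψ - ψ.smulRight τ + (φ.smulRight χ - χ.smulRight φ) := by
    refine eq_of_single fun a b => ?_
    simp only [LinearMap.compr₂_apply, LinearMap.sub_apply, LinearMap.add_apply,
      smulRight_apply_apply, φ, ψ, χ, τ, LinearMap.proj_apply, LinearMap.smul_apply]
    rcases a with i | l | j <;> rcases b with i' | l' | j' <;>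
      simp only [single_X, single_T, single_Y, bracket_X_X, bracket_X_T, bracket_T_X,
        bracket_T_T, bracket_X_Y, bracket_Y_X, bracket_T_Y, bracket_Y_T, bracket_Y_Y, ite_apply,
        Pi.neg_apply, Pi.smul_apply, Pi.zero_apply, smul_eq_mul,
        X_apply_X, X_apply_T, X_apply_Y, Y_apply_X, Y_apply_T, Y_apply_Y, T_apply_X, T_apply_T,
        T_apply_Y, wX, wY]
    all_goals (try split_ifs) <;> first | omega | (simp; done) | simp_all
  exact LinearMap.congr_fun (LinearMap.congr_fun h x) y

theorem eq_of_single_left {M : Type*} [AddCommGroup M] [Module K M]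
    {f g : SLSpace K n m →ₗ[K] M} (h : ∀ a : SLIndex n m, f (Pi.single a 1) = g (Pi.single a 1)) :
    f = g :=
  (Pi.basisFun K _).ext fun a => by simpa only [Pi.basisFun_apply] using h a

theorem bracket_X_two (hn : 0 < n) (x : SLSpace K n m) : bracket K n m x (X K n m 2) =
    (2 * x (.T 0) + x (.T 1)) • X K n m 2 + x (.X ⟨0, hn⟩) • X K n m 3 := by
  let φ : SLSpace K n m →ₗ[K] K := LinearMap.proj (.X ⟨0, hn⟩)
  let τ : SLSpace K n m →ₗ[K] K := (2 : K) • LinearMap.proj (.T 0) + LinearMap.proj (.T 1)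
  have h : (bracket K n m).flip (X K n m 2) =
      τ.smulRight (X K n m 2) + φ.smulRight (X K n m 3) := by
    refine eq_of_single_left fun a => ?_
    simp only [LinearMap.flip_apply, LinearMap.add_apply, LinearMap.smulRight_apply, φ, τ,
      LinearMap.proj_apply, LinearMap.smul_apply]
    rcases a with i | l | j <;>
      simp only [single_X, single_T, single_Y, bracket_X_X, bracket_T_X, bracket_Y_X, bracket_X_Y,
        smul_eq_mul, X_apply_X, X_apply_T, Y_apply_X, Y_apply_T, T_apply_X, T_apply_T, wX]
    all_goals (try split_ifs) <;> first | omega | simp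
  exact LinearMap.congr_fun h x

theorem bracket_Y_one (hn : 0 < n) (x : SLSpace K n m) : bracket K n m x (Y K n m 1) =
    (x (.T 0) + x (.T 2)) • Y K n m 1 + x (.X ⟨0, hn⟩) • Y K n m 2 := by
  let φ : SLSpace K n m →ₗ[K] K := LinearMap.proj (.X ⟨0, hn⟩)
  let τ : SLSpace K n m →ₗ[K] K := LinearMap.proj (.T 0) + LinearMap.proj (.T 2)
  have h : (bracket K n m).flip (Y K n m 1) =
      τ.smulRight (Y K n m 1) + φ.smulRight (Y K n m 2) := by
    refine eq_of_single_left fun a => ?_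
    simp only [LinearMap.flip_apply, LinearMap.add_apply, LinearMap.smulRight_apply, φ, τ,
      LinearMap.proj_apply]
    rcases a with i | l | j <;>
      simp only [single_X, single_T, single_Y, bracket_X_Y, bracket_T_Y, bracket_Y_Y,
        X_apply_X, X_apply_T, Y_apply_X, Y_apply_T, T_apply_X, T_apply_T, wY]
    all_goals (try split_ifs) <;> first | omega | simp
  exact LinearMap.congr_fun h x

/-! ### The cocycles `c₁` and `c₂` -/

theorem c1_eq_wedge {p : ℕ} (hp : 1 ≤ p) (hn : 0 < n) (hm : p ≤ m) : c1 K n m p =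
    LieSuperalgebra.wedge (LinearMap.proj (.X ⟨0, hn⟩)) (LinearMap.proj (.Y ⟨p - 1, by omega⟩))
      (Y K n m 1) := by
  refine eq_of_single fun a b => ?_
  rw [c1, bilin_single, LieSuperalgebra.wedge_apply]
  simp only [LinearMap.proj_apply]
  rcases a with i | l | j <;> rcases b with i' | l' | j' <;>
    simp only [single_X, single_T, single_Y, X_apply_X, X_apply_T, X_apply_Y, Y_apply_X,
      Y_apply_T, Y_apply_Y, T_apply_X, T_apply_T, T_apply_Y]
  all_goals (try split_ifs) <;> first | omega | simp

theorem c2_eq_wedge {p : ℕ} (hp : 1 ≤ p) (hn : p < n) : c2 K n m p =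
    LieSuperalgebra.wedge (LinearMap.proj (.X ⟨0, by omega⟩)) (LinearMap.proj (.X ⟨p, hn⟩))
      (X K n m 2) := by
  refine eq_of_single fun a b => ?_
  rw [c2, bilin_single, LieSuperalgebra.wedge_apply]
  simp only [LinearMap.proj_apply]
  rcases a with i | l | j <;> rcases b with i' | l' | j' <;>
    simp only [single_X, single_T, single_Y, X_apply_X, X_apply_T, X_apply_Y, Y_apply_X,
      Y_apply_T, Y_apply_Y, T_apply_X, T_apply_T, T_apply_Y]
  all_goals (try split_ifs) <;> first | omega | simp

theorem c1_eq_zero {p : ℕ} (hm : m < p) : c1 K n m p = 0 := by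
  refine eq_of_single fun a b => ?_
  rw [c1, bilin_single]
  rcases a with i | l | j <;> rcases b with i' | l' | j' <;> try rfl
  all_goals exact if_neg (by omega)

theorem c2_eq_zero {p : ℕ} (hn : n < p + 1) : c2 K n m p = 0 := by
  refine eq_of_single fun a b => ?_
  rw [c2, bilin_single]
  rcases a with i | l | j <;> rcases b with i' | l' | j' <;> try rfl
  exact (if_neg (by omega)).trans (if_neg (by omega))

theorem c1_mem_Z2_of_le {p : ℕ} [CharP K p] (hp : 2 ≤ p) (hn : 0 < n) (hm : p ≤ m) :
    c1 K n m p ∈ (SL K n m).Z2 := by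
  rw [c1_eq_wedge (by omega) hn hm]
  -- The `T₁`-weight of `Y_p` vanishes in characteristic `p`, so the weights of `X₁` and `Y_p` add
  -- up to that of `Y₁`.
  have cast : ((p - 1 : ℕ) : K) + 1 = 0 := by
    rw [← Nat.cast_succ, Nat.succ_eq_add_one, Nat.sub_add_cancel (by omega), CharP.cast_eq_zero]
  refine LieSuperalgebra.wedge_mem_Z2 _ _ _ (LinearMap.proj (.Y ⟨p - 1 - 1, by omega⟩))
    (LinearMap.proj (.T 0)) (LinearMap.proj (.T 2)) _ (Y K n m 2) ?_ ?_ ?_ ?_ ?_ ?_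
  · exact fun x hx => hx _ (by simp [parity])
  · exact fun x hx => hx _ (by simp [parity])
  · exact fun x hx => hx _ (by simp [parity])
  · exact bracket_apply_X_one hn
  · intro x y
    refine (bracket_apply_Y_succ hn (by omega) _ x y).trans ?_
    simp only [cast, LinearMap.proj_apply, zero_mul, zero_add]
  · exact bracket_Y_one hn

theorem c2_mem_Z2_of_lt {p : ℕ} [CharP K p] (hp : 2 ≤ p) (hn : p < n) :
    c2 K n m p ∈ (SL K n m).Z2 := by
  rw [c2_eq_wedge (by omega) hn]
  -- In characteristic `p` the `T₁`-weight `p + 1` of `X_{p+1}` equals `1`, so its weight form is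
  -- the sum of the coordinates of `T₁` and `T₂`. Adding the form of `X₁` gives the weight form of
  -- `X₂`.
  refine LieSuperalgebra.wedge_mem_Z2 _ _ _ (LinearMap.proj (.X ⟨p - 1, by omega⟩))
    (LinearMap.proj (.T 0)) (LinearMap.proj (.T 0) + LinearMap.proj (.T 1)) _ (X K n m 3)
    ?_ ?_ ?_ ?_ ?_ ?_
  · exact fun x hx => hx _ (by simp [parity])
  · exact fun x hx => hx _ (by simp [parity])
  · intro x hx
    rw [LinearMap.add_apply, LinearMap.proj_apply, LinearMap.proj_apply,
      hx _ (by simp [parity]), hx _ (by simp [parity]), add_zero]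
  · exact bracket_apply_X_one _
  · intro x y
    refine (bracket_apply_X_succ hp hn x y).trans ?_
    simp only [CharP.cast_eq_zero, LinearMap.proj_apply, LinearMap.add_apply, zero_add, one_mul]
  · intro x
    refine (bracket_X_two (by omega) x).trans ?_
    simp only [LinearMap.proj_apply, LinearMap.add_apply]
    module

theorem isEven_of_single {c : SLSpace K n m →ₗ[K] SLSpace K n m →ₗ[K] SLSpace K n m}
    (h : ∀ a b : SLIndex n m,
      c (Pi.single a 1) (Pi.single b 1) ∈ part K n m (parity a + parity b)) :
    (SL K n m).IsEven c := by
  intro α β x y hx hy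
  revert x
  refine part_induction (P := fun y => ∀ x, x ∈ (SL K n m).part α →
    c x y ∈ part K n m (α + β)) ?_ ?_ ?_ ?_ hy
  · simp
  · intro y y' h h' x hx
    rw [map_add]
    exact add_mem (h x hx) (h' x hx)
  · intro r y h x hx
    rw [map_smul]
    exact Submodule.smul_mem _ _ (h x hx)
  · rintro b rfl x hx
    refine part_induction (P := fun x => c x _ ∈ part K n m _) ?_ ?_ ?_ ?_ hx
    · simp
    · intro y y' h h'
      rw [map_add]
      exact add_mem h h'
    · intro r y h
      rw [map_smul]
      exact Submodule.smul_mem _ _ h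
    · rintro a rfl
      exact h a b

theorem c1_isEven (p : ℕ) : (SL K n m).IsEven (c1 K n m p) := by
  refine isEven_of_single fun a b => ?_
  rw [c1, bilin_single]
  intro e he
  rcases a with i | l | j <;> rcases b with i' | l' | j' <;> rcases e with i'' | l'' | j'' <;>
    simp_all [parity, ite_apply, Y_apply_X, Y_apply_T]

theorem c2_isEven (p : ℕ) : (SL K n m).IsEven (c2 K n m p) := by
  refine isEven_of_single fun a b => ?_
  rw [c2, bilin_single]
  intro e he
  rcases a with i | l | j <;> rcases b with i' | l' | j' <;> rcases e with i'' | l'' | j'' <;>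
    simp_all [parity, ite_apply, X_apply_Y, X_apply_T]

theorem c1_hasDegree (p : ℕ) : HasDegree (c1 K n m p) (-(p : ℤ)) := by
  intro a b e h
  rw [c1, bilin_single] at h
  rcases a with i | l | j <;> rcases b with i' | l' | j' <;> rcases e with i'' | l'' | j'' <;>
    simp [ite_apply, Y_apply_X, Y_apply_T, Y_apply_Y] at h <;> simp only [deg] <;> omega

theorem c2_hasDegree (p : ℕ) : HasDegree (c2 K n m p) (-(p : ℤ)) := by
  intro a b e h
  rw [c2, bilin_single] at h
  rcases a with i | l | j <;> rcases b with i' | l' | j' <;> rcases e with i'' | l'' | j'' <;>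
    simp [ite_apply, X_apply_X, X_apply_T, X_apply_Y] at h <;> simp only [deg]
  split_ifs at h <;> simp_all
  all_goals omega

end SLSpace

namespace LieSuperalgebra

variable {K : Type*} [Field K] {L : Type*} [AddCommGroup L] [Module K L]

theorem d1_skew (G : LieSuperalgebra K L) (b : L →ₗ[K] L) {α β : ZMod 2} {x y : L}
    (hx : x ∈ G.part α) (hy : y ∈ G.part β) :
    G.d1 b α β x y = -((-1 : K) ^ (α.val * β.val) • G.d1 b β α y x) := by
  have h : (-1 : K) ^ (α.val * β.val) * (-1 : K) ^ (α.val * β.val) = 1 := by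
    rw [← mul_pow]
    simp
  rw [d1, d1, G.skew α β x y hx hy, mul_comm β.val, smul_add, smul_smul, h, map_neg, map_smul]
  module

end LieSuperalgebra

namespace SLSpace

variable {K : Type*} [Field K] {n m : ℕ}

/-- Both `c` and the differential of `b` are super-skew, so one order of each pair of basis vectors
suffices. -/
theorem mem_B2_of_single_or {c : SLSpace K n m →ₗ[K] SLSpace K n m →ₗ[K] SLSpace K n m}
    (hc : c ∈ (SL K n m).C2) (b : SLSpace K n m →ₗ[K] SLSpace K n m)
    (h : ∀ a a' : SLIndex n m,
      c (Pi.single a 1) (Pi.single a' 1) =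
        (SL K n m).d1 b (parity a) (parity a') (Pi.single a 1) (Pi.single a' 1) ∨
      c (Pi.single a' 1) (Pi.single a 1) =
        (SL K n m).d1 b (parity a') (parity a) (Pi.single a' 1) (Pi.single a 1)) :
    c ∈ (SL K n m).B2 := by
  refine mem_B2_of_single b fun a a' => ?_
  rcases h a a' with h | h
  · exact h
  · rw [hc _ _ _ _ (single_mem_part a) (single_mem_part a'), h,
      (SL K n m).d1_skew b (single_mem_part a) (single_mem_part a')]

/-! ### Weights separate the basis of the nilradical -/

/-- Congruence mod `p` in a form that linear arithmetic can use together with the bounds on `n` and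
`m`. -/
theorem natCast_eq_or (p : ℕ) [CharP K p] {a b : ℕ} (h : (a : K) = b) :
    a = b ∨ a + p ≤ b ∨ b + p ≤ a := by
  by_contra! hlt
  exact hlt.1 (((CharP.natCast_eq_natCast K p).1 h).eq_of_abs_lt (by rw [abs_lt]; omega))

theorem two_ne_zero_of_lt (p : ℕ) [CharP K p] (hp : 2 < p) : (2 : K) ≠ 0 := by
  intro h
  have := natCast_eq_or (K := K) p (a := 2) (b := 0) (by simpa using h)
  omega

theorem X_ne_zero {k : ℕ} (h : 1 ≤ k) (hn : k ≤ n) : X K n m k ≠ 0 := by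
  intro h0
  have := congrFun h0 (.X ⟨k - 1, by omega⟩)
  simp only [X_apply_X, Pi.zero_apply, ite_eq_right_iff, one_ne_zero, imp_false] at this
  omega

theorem Y_ne_zero {k : ℕ} (h : 1 ≤ k) (hm : k ≤ m) : Y K n m k ≠ 0 := by
  intro h0
  have := congrFun h0 (.Y ⟨k - 1, by omega⟩)
  simp only [Y_apply_Y, Pi.zero_apply, ite_eq_right_iff, one_ne_zero, imp_false] at this
  omega

theorem wt_T (l l' : Fin 3) : wt K l (.T l' : SLIndex n m) = 0 := rfl

theorem wt_X_zero (i : Fin n) : wt K 0 (.X i : SLIndex n m) = ((i.val + 1 : ℕ) : K) := rfl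

theorem wt_X_one (i : Fin n) : wt K 1 (.X i : SLIndex n m) = if 1 ≤ i.val then 1 else 0 := by
  simp [wt, wX]

theorem wt_X_two (i : Fin n) : wt K 2 (.X i : SLIndex n m) = 0 := rfl

theorem wt_Y_zero (j : Fin m) : wt K 0 (.Y j : SLIndex n m) = ((j.val + 1 : ℕ) : K) := rfl

theorem wt_Y_one (j : Fin m) : wt K 1 (.Y j : SLIndex n m) = 0 := rfl

theorem wt_Y_two (j : Fin m) : wt K 2 (.Y j : SLIndex n m) = 1 := rfl

theorem exists_T_of_wt_eq_zero {e : SLIndex n m} (h : ∀ l, wt K l e = 0) : ∃ l, e = .T l := by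
  rcases e with i | l | j
  · have h0 := h 0
    have h1 := h 1
    rw [wt_X_one] at h1
    split_ifs at h1 with hi
    · exact absurd h1 one_ne_zero
    · have : i.val = 0 := by omega
      simp [wt_X_zero, this] at h0
  · exact ⟨l, rfl⟩
  · exact absurd (h 2) one_ne_zero

/-- The `T₁`-weight fixes the index mod `p`. For `n ≤ p + 1` the only possible collision is `X₁`
with `X_{p+1}`, which `T₂` separates. -/
theorem eq_X_of_wt_eq (p : ℕ) [CharP K p] (hp : 1 ≤ p) (hn : n ≤ p + 1)
    {e : SLIndex n m} {i : Fin n}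
    (h : ∀ l, wt K l e = wt K l (.X i : SLIndex n m)) : e = .X i := by
  rcases e with i' | l | j
  · have h1 := h 1
    rw [wt_X_one, wt_X_one] at h1
    rcases natCast_eq_or p (h 0) with h0 | h0 | h0
    · exact congrArg _ (Fin.ext (by omega))
    all_goals
      split_ifs at h1
      · omega
      · exact absurd h1 (by simp)
      · exact absurd h1 (by simp)
      · omega
  · obtain ⟨l', hl'⟩ := exists_T_of_wt_eq_zero fun l => (h l).symm
    cases hl'
  · exact absurd (h 2) one_ne_zero

theorem eq_Y_of_wt_eq (p : ℕ) [CharP K p] (hm : m ≤ p) {e : SLIndex n m} {j : Fin m}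
    (h : ∀ l, wt K l e = wt K l (.Y j : SLIndex n m)) : e = .Y j := by
  rcases e with i | l | j'
  · exact absurd (h 2).symm one_ne_zero
  · exact absurd (h 2).symm one_ne_zero
  · rcases natCast_eq_or p (h 0) with h0 | h0 | h0
    · exact congrArg _ (Fin.ext (by omega))
    all_goals omega

/-! ### Support of a weight-zero cocycle -/

section Support

variable {c : SLSpace K n m →ₗ[K] SLSpace K n m →ₗ[K] SLSpace K n m}

/-- A weight-zero map sends a pair whose total weight is that of no basis vector to zero. -/
theorem IsWeightZero.eq_zero (hw : IsWeightZero c) {a b : SLIndex n m}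
    (h : ∀ e : SLIndex n m, ∃ l, wt K l e ≠ wt K l a + wt K l b) :
    c (Pi.single a 1) (Pi.single b 1) = 0 := by
  funext e
  by_contra hne
  obtain ⟨l, hl⟩ := h e
  exact hl (hw a b e hne l)

/-- A weight-zero map sends a pair whose total weight is that of one basis vector only to a
multiple of this vector. -/
theorem IsWeightZero.eq_smul (hw : IsWeightZero c) {a b d : SLIndex n m}
    (h : ∀ e : SLIndex n m, (∀ l, wt K l e = wt K l a + wt K l b) → e = d) :
    c (Pi.single a 1) (Pi.single b 1) =
      c (Pi.single a 1) (Pi.single b 1) d • Pi.single d 1 := by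
  funext e
  by_cases he : e = d
  · simp [he]
  · rw [Pi.smul_apply, Pi.single_apply, if_neg he, smul_zero]
    by_contra hne
    exact he (h e (hw a b e hne))

theorem IsWeightZero.T_X (hw : IsWeightZero c) (p : ℕ) [CharP K p] (hp : 1 ≤ p)
    (hn : n ≤ p + 1) (l : Fin 3) (k : ℕ) : ∃ r : K, c (T K n m l) (X K n m k) = r • X K n m k := by
  rcases X_cases (K := K) (n := n) (m := m) k with ⟨h, -⟩ | ⟨i, rfl, h⟩
  · exact ⟨0, by rw [h, map_zero, smul_zero]⟩
  · rw [h, ← single_T]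
    refine ⟨_, hw.eq_smul fun e he => eq_X_of_wt_eq (K := K) p hp hn fun l' => ?_⟩
    rw [he, wt_T, zero_add]

theorem IsWeightZero.T_Y (hw : IsWeightZero c) (p : ℕ) [CharP K p] (hm : m ≤ p) (l : Fin 3)
    (k : ℕ) : ∃ r : K, c (T K n m l) (Y K n m k) = r • Y K n m k := by
  rcases Y_cases (K := K) (n := n) (m := m) k with ⟨h, -⟩ | ⟨i, rfl, h⟩
  · exact ⟨0, by rw [h, map_zero, smul_zero]⟩
  · rw [h, ← single_T]
    refine ⟨_, hw.eq_smul fun e he => eq_Y_of_wt_eq (K := K) p hm fun l' => ?_⟩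
    rw [he, wt_T, zero_add]

/-- The pair has `T₂`-weight `2`, while basis vectors have `T₂`-weight `0` or `1`; these differ as
the characteristic is not `2`. -/
theorem IsWeightZero.X_X_eq_zero (hw : IsWeightZero c) (h2 : (2 : K) ≠ 0) {i i' : Fin n}
    (hi : 1 ≤ i.val) (hi' : 1 ≤ i'.val) :
    c (Pi.single (.X i) 1) (Pi.single (.X i') 1) = 0 := by
  refine hw.eq_zero fun e => ⟨1, ?_⟩
  rw [wt_X_one, wt_X_one, if_pos hi, if_pos hi', one_add_one_eq_two]
  rcases e with i | l | j
  · rw [wt_X_one]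
    split_ifs
    · intro h
      rw [← one_add_one_eq_two, eq_comm, add_eq_left] at h
      exact one_ne_zero h
    · exact h2.symm
  · exact h2.symm
  · exact h2.symm

theorem IsWeightZero.X_Y_eq_zero (hw : IsWeightZero c) {i : Fin n} {j : Fin m}
    (hi : 1 ≤ i.val) : c (Pi.single (.X i) 1) (Pi.single (.Y j) 1) = 0 := by
  refine hw.eq_zero fun e => ?_
  rcases e with i' | l | j'
  · exact ⟨2, by simp [wt_X_two, wt_Y_two]⟩
  · exact ⟨2, by simp [wt_X_two, wt_Y_two, wt_T]⟩
  · exact ⟨1, by simp [wt_X_one, wt_Y_one, hi]⟩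

theorem IsWeightZero.Y_Y_eq_zero (hw : IsWeightZero c) (h2 : (2 : K) ≠ 0) (j j' : Fin m) :
    c (Pi.single (.Y j) 1) (Pi.single (.Y j') 1) = 0 := by
  refine hw.eq_zero fun e => ⟨2, ?_⟩
  rw [wt_Y_two, wt_Y_two, one_add_one_eq_two]
  rcases e with i | l | j
  · exact h2.symm
  · exact h2.symm
  · rw [wt_Y_two, ← one_add_one_eq_two]
    simp

theorem IsWeightZero.T_T_apply (hw : IsWeightZero c) (l l' : Fin 3) {e : SLIndex n m}
    (he : c (T K n m l) (T K n m l') e ≠ 0) : ∃ r, e = .T r := by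
  rw [← single_T, ← single_T] at he
  refine exists_T_of_wt_eq_zero (K := K) fun r => ?_
  rw [hw _ _ _ he, wt_T, wt_T, add_zero]

/-- The target has `T₂`-weight `1` and index congruent to `k + 1` mod `p`. With indices between `2`
and `p + 1` this forces `X_{k+1}`, or the wrap-around to `X₂` when `k = p + 1`. For `k = n ≠ p + 1`
the right-hand side is zero, since `X_{n+1} = 0` by convention. -/
theorem IsWeightZero.X_one_X (hw : IsWeightZero c) (p : ℕ) [CharP K p] (hp : 1 ≤ p)
    (hn1 : 1 < n) (hn : n ≤ p + 1) {k : ℕ} (hk : 2 ≤ k) :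
    (k ≠ p + 1 → ∃ r : K, c (X K n m 1) (X K n m k) = r • X K n m (k + 1)) ∧
    ∃ r : K, c (X K n m 1) (X K n m (p + 1)) = r • X K n m 2 := by
  have aux : ∀ (i : Fin n) (e : SLIndex n m), 1 ≤ i.val →
      (∀ l, wt K l e = wt K l (.X ⟨0, by omega⟩ : SLIndex n m) + wt K l (.X i : SLIndex n m)) →
      ∃ i' : Fin n, e = .X i' ∧ (i'.val = i.val + 1 ∨ i.val = p ∧ i'.val = 1) := by
    intro i e hi h
    have h1 := h 1
    have h0 := h 0
    simp only [wt_X_one, hi, if_true, zero_add, show ¬ (1 ≤ 0) by omega, if_false] at h1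
    rcases e with i' | l | j
    · refine ⟨i', rfl, ?_⟩
      rw [wt_X_one] at h1
      rw [wt_X_zero, wt_X_zero, wt_X_zero, ← Nat.cast_add] at h0
      have hi' : 1 ≤ i'.val := by
        by_contra h
        rw [if_neg h] at h1
        exact zero_ne_one h1
      simp only at h0
      have := natCast_eq_or p h0
      omega
    · exact absurd h1 zero_ne_one
    · exact absurd h1 zero_ne_one
  have e1 : X K n m 1 = Pi.single (.X ⟨0, by omega⟩) 1 :=
    (single_X (⟨0, by omega⟩ : Fin n)).symm
  constructor
  · intro hkp
    rcases X_cases (K := K) (n := n) (m := m) k with ⟨h, -⟩ | ⟨i, rfl, h⟩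
    · exact ⟨0, by rw [h, map_zero, zero_smul]⟩
    · rw [e1, h]
      rcases X_cases (K := K) (n := n) (m := m) (i.val + 1 + 1) with ⟨h', hk'⟩ | ⟨i', hi', h'⟩
      · refine ⟨0, ?_⟩
        rw [zero_smul]
        refine hw.eq_zero fun e => ?_
        by_contra! hall
        obtain ⟨i', -, hi'⟩ := aux i e (by omega) hall
        omega
      · rw [h']
        refine ⟨_, hw.eq_smul fun e he => ?_⟩
        obtain ⟨i'', rfl, hi''⟩ := aux i e (by omega) he
        exact congrArg _ (Fin.ext (by omega))
  · rcases X_cases (K := K) (n := n) (m := m) (p + 1) with ⟨h, -⟩ | ⟨i, hi, h⟩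
    · exact ⟨0, by rw [h, map_zero, zero_smul]⟩
    · have e2 : X K n m 2 = Pi.single (.X ⟨1, hn1⟩) 1 := (single_X (⟨1, hn1⟩ : Fin n)).symm
      rw [e1, h, e2]
      refine ⟨_, hw.eq_smul fun e he => ?_⟩
      obtain ⟨i', rfl, hi'⟩ := aux i e (by omega) he
      exact congrArg _ (Fin.ext (by simp only; omega))

/-- Here the index runs over `1, …, p`, so the wrap-around occurs at `k = p` and lands on `Y₁`. -/
theorem IsWeightZero.X_one_Y (hw : IsWeightZero c) (p : ℕ) [CharP K p]
    (hn1 : 1 < n) (hm1 : 1 ≤ m) (hm : m ≤ p) {k : ℕ} (hk : 1 ≤ k) :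
    (k ≠ p → ∃ r : K, c (X K n m 1) (Y K n m k) = r • Y K n m (k + 1)) ∧
    ∃ r : K, c (X K n m 1) (Y K n m p) = r • Y K n m 1 := by
  have aux : ∀ (i : Fin m) (e : SLIndex n m),
      (∀ l, wt K l e = wt K l (.X ⟨0, by omega⟩ : SLIndex n m) + wt K l (.Y i : SLIndex n m)) →
      ∃ i' : Fin m, e = .Y i' ∧ (i'.val = i.val + 1 ∨ i.val + 1 = p ∧ i'.val = 0) := by
    intro i e h
    have h2 := h 2
    have h0 := h 0
    rw [wt_X_two, zero_add, wt_Y_two] at h2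
    rcases e with i' | l | j
    · exact absurd h2 zero_ne_one
    · exact absurd h2 zero_ne_one
    · refine ⟨j, rfl, ?_⟩
      rw [wt_X_zero, wt_Y_zero, wt_Y_zero, ← Nat.cast_add] at h0
      simp only at h0
      have := natCast_eq_or p h0
      omega
  have e1 : X K n m 1 = Pi.single (.X ⟨0, by omega⟩) 1 :=
    (single_X (⟨0, by omega⟩ : Fin n)).symm
  constructor
  · intro hkp
    rcases Y_cases (K := K) (n := n) (m := m) k with ⟨h, -⟩ | ⟨i, rfl, h⟩
    · exact ⟨0, by rw [h, map_zero, zero_smul]⟩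
    · rw [e1, h]
      rcases Y_cases (K := K) (n := n) (m := m) (i.val + 1 + 1) with ⟨h', hk'⟩ | ⟨i', hi', h'⟩
      · refine ⟨0, ?_⟩
        rw [zero_smul]
        refine hw.eq_zero fun e => ?_
        by_contra! hall
        obtain ⟨i', -, hi'⟩ := aux i e hall
        omega
      · rw [h']
        refine ⟨_, hw.eq_smul fun e he => ?_⟩
        obtain ⟨i'', rfl, hi''⟩ := aux i e he
        exact congrArg _ (Fin.ext (by omega))
  · rcases Y_cases (K := K) (n := n) (m := m) p with ⟨h, -⟩ | ⟨i, hi, h⟩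
    · exact ⟨0, by rw [h, map_zero, zero_smul]⟩
    · have e2 : Y K n m 1 = Pi.single (.Y ⟨0, hm1⟩) 1 := (single_Y (⟨0, hm1⟩ : Fin m)).symm
      rw [e1, h, e2]
      refine ⟨_, hw.eq_smul fun e he => ?_⟩
      obtain ⟨i', rfl, hi'⟩ := aux i e he
      exact congrArg _ (Fin.ext (by simp only; omega))

/-- Contracting a weight-zero cocycle with an element of the torus gives a 1-cocycle. -/
theorem IsWeightZero.d1_T (hw : IsWeightZero c) (hc : c ∈ (SL K n m).Z2) (l : Fin 3)
    (α β : ZMod 2) {x y : SLSpace K n m} (hx : x ∈ part K n m α) (hy : y ∈ part K n m β) :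
    (SL K n m).d1 (c (T K n m l)) α β x y = 0 := by
  have h0 : (SL K n m).lieDeriv (T K n m l) c = 0 := by
    refine eq_of_single fun a b => funext fun e => ?_
    have h := lieDeriv_T_iterate_single l 1 c a b e
    rw [Function.iterate_one] at h
    rw [h]
    by_cases hne : c (Pi.single a 1) (Pi.single b 1) e = 0
    · rw [hne, mul_zero]
      rfl
    · rw [hw a b e hne l]
      simp
  have h := (SL K n m).lieDeriv_apply_of_mem_Z2 (T_mem_part l) hc α β hx hy
  rw [h0] at h
  exact neg_eq_zero.1 h.symm

end Support

/-! ### Contraction with the torus -/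

theorem X_mem_part (k : ℕ) : X K n m k ∈ part K n m 0 := by
  rcases X_cases (K := K) (n := n) (m := m) k with ⟨h, -⟩ | ⟨i, -, h⟩ <;> rw [h]
  · exact zero_mem _
  · exact single_mem_part (.X i)

theorem Y_mem_part (k : ℕ) : Y K n m k ∈ part K n m 1 := by
  rcases Y_cases (K := K) (n := n) (m := m) k with ⟨h, -⟩ | ⟨i, -, h⟩ <;> rw [h]
  · exact zero_mem _
  · exact single_mem_part (.Y i)

/-- For an even first argument, the differential of a 1-cochain carries no signs. -/
theorem d1_zero_left (b : SLSpace K n m →ₗ[K] SLSpace K n m) (β : ZMod 2) (x y : SLSpace K n m) :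
    (SL K n m).d1 b 0 β x y =
      b (bracket K n m x y) - bracket K n m x (b y) + bracket K n m y (b x) := by
  have v0 : (0 : ZMod 2).val = 0 := rfl
  rw [LieSuperalgebra.d1, v0, zero_mul, pow_zero, one_smul]
  rfl

/-- The torus acts faithfully. -/
theorem eq_zero_of_bracket_eq_zero (hn : 1 < n) (hm : 1 ≤ m) {v : SLSpace K n m}
    (hv : ∀ e, v e ≠ 0 → ∃ r, e = .T r) (hX : ∀ k, bracket K n m v (X K n m k) = 0)
    (hY : bracket K n m v (Y K n m 1) = 0) : v = 0 := by
  have hvX : ∀ i, v (.X i) = 0 := fun i => by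
    by_contra h
    obtain ⟨r, hr⟩ := hv _ h
    cases hr
  have hvY : ∀ j, v (.Y j) = 0 := fun j => by
    by_contra h
    obtain ⟨r, hr⟩ := hv _ h
    cases hr
  have h0 : v (.T 0) = 0 := by
    have h := congrFun (hX 1) (.X ⟨0, by omega⟩)
    rw [bracket_apply_X_one] at h
    simpa [X_apply_X, X_apply_T] using h
  have h1 : v (.T 1) = 0 := by
    have h := hX 2
    rw [bracket_X_two (by omega), hvX, zero_smul, add_zero, h0, mul_zero, zero_add] at h
    exact (smul_eq_zero.1 h).resolve_right (X_ne_zero one_le_two hn)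
  have h2 : v (.T 2) = 0 := by
    rw [bracket_Y_one (by omega), hvX, zero_smul, add_zero, h0, zero_add] at hY
    exact (smul_eq_zero.1 hY).resolve_right (Y_ne_zero le_rfl hm)
  funext e
  rcases e with i | l | j
  · exact hvX i
  · fin_cases l
    exacts [h0, h1, h2]
  · exact hvY j

variable {c : SLSpace K n m →ₗ[K] SLSpace K n m →ₗ[K] SLSpace K n m}

/-- The contraction of `c` with `T_l` is a 1-cocycle that is diagonal on the nilradical. Evaluating
its differential at a torus element and a nilradical basis vector, the diagonal terms cancel, and
`c(T_l, T_l')` is seen to centralize that vector. Weight zero puts this value in the torus, which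
acts faithfully. -/
theorem IsWeightZero.T_T_eq_zero (hw : IsWeightZero c) (hc : c ∈ (SL K n m).Z2) (p : ℕ)
    [CharP K p] (hp : 1 ≤ p) (hn1 : 1 < n) (hn : n ≤ p + 1) (hm1 : 1 ≤ m) (hm : m ≤ p)
    (l l' : Fin 3) : c (T K n m l) (T K n m l') = 0 := by
  refine eq_zero_of_bracket_eq_zero hn1 hm1 (fun e => hw.T_T_apply l l') (fun k => ?_) ?_
  · have h := hw.d1_T hc l 0 0 (T_mem_part l') (X_mem_part k)
    obtain ⟨r, hr⟩ := hw.T_X p hp hn l k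
    rw [d1_zero_left, bracket_T_X, map_smul, hr, map_smul, bracket_T_X, smul_comm, sub_self,
      zero_add] at h
    rw [bracket_neg, h, neg_zero]
  · have h := hw.d1_T hc l 0 1 (T_mem_part l') (Y_mem_part 1)
    obtain ⟨r, hr⟩ := hw.T_Y p hm l 1
    rw [d1_zero_left, bracket_T_Y, map_smul, hr, map_smul, bracket_T_Y, smul_comm, sub_self,
      zero_add] at h
    rw [bracket_neg, h, neg_zero]

/-- On the nilradical, the contraction of a weight-zero cocycle with an element of the torus is
the inner derivation of an element of the torus. -/
theorem IsWeightZero.exists_inner (hw : IsWeightZero c) (hc : c ∈ (SL K n m).Z2) (p : ℕ)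
    [CharP K p] (hp : 1 ≤ p) (hn1 : 1 < n) (hn : n ≤ p + 1) (hm : m ≤ p)
    (l : Fin 3) : ∃ t : SLSpace K n m, (∀ l', bracket K n m (T K n m l') t = 0) ∧
      (∀ k, c (T K n m l) (X K n m k) = bracket K n m t (X K n m k)) ∧
      ∀ k, c (T K n m l) (Y K n m k) = bracket K n m t (Y K n m k) := by
  choose α hα using hw.T_X p hp hn l
  choose β hβ using hw.T_Y p hm l
  -- The eigenvalues of a diagonal derivation add along `[X₁, X_k] = X_{k+1}`.
  have hX : ∀ k, 2 ≤ k → k + 1 ≤ n → α (k + 1) = α 1 + α k := by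
    intro k hk hkn
    have h := hw.d1_T hc l 0 0 (X_mem_part 1) (X_mem_part k)
    rw [d1_zero_left, hα, hα, map_smul, map_smul, bracket_neg (X K n m k),
      bracket_X_X, if_pos ⟨rfl, hk⟩, hα, smul_neg, ← sub_eq_add_neg, ← sub_smul, ← sub_smul] at h
    have := (smul_eq_zero.1 h).resolve_right (X_ne_zero (by omega) hkn)
    linear_combination this
  have hY : ∀ k, 1 ≤ k → k + 1 ≤ m → β (k + 1) = α 1 + β k := by
    intro k hk hkm
    have h := hw.d1_T hc l 0 1 (X_mem_part 1) (Y_mem_part k)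
    rw [d1_zero_left, hα, hβ, map_smul, map_smul, bracket_neg (Y K n m k),
      bracket_X_Y, if_pos ⟨rfl, hk, by omega⟩, hβ, smul_neg, ← sub_eq_add_neg, ← sub_smul,
      ← sub_smul] at h
    have := (smul_eq_zero.1 h).resolve_right (Y_ne_zero (by omega) hkm)
    linear_combination this
  -- The coefficients solve for the prescribed eigenvalues on the generators `X₁`, `X₂`, `Y₁` of the
  -- nilradical; additivity propagates the match to the other basis vectors.
  refine ⟨α 1 • T K n m 0 + (α 2 - 2 * α 1) • T K n m 1 + (β 1 - α 1) • T K n m 2,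
    fun l' => ?_, fun k => ?_, fun k => ?_⟩
  · simp only [map_add, map_smul, bracket_T_T, smul_zero, add_zero]
  · simp only [map_add, map_smul, LinearMap.add_apply, LinearMap.smul_apply, bracket_T_X, hα,
      smul_smul, ← add_smul]
    rcases X_cases (K := K) (n := n) (m := m) k with ⟨h, -⟩ | ⟨i, hi, -⟩
    · rw [h, smul_zero, smul_zero]
    · congr 1
      have hk : 1 ≤ k := by omega
      have hkn : k ≤ n := by omega
      clear hi
      induction k, hk using Nat.le_induction with
      | base => simp [wX]
      | succ k hk ih =>
        rcases hk.eq_or_lt with rfl | hk'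
        · simp [wX]
          ring
        · rw [hX k hk' hkn, ih (by omega)]
          simp [wX, show 1 ≤ k from hk, show 2 ≤ k from hk']
          ring
  · simp only [map_add, map_smul, LinearMap.add_apply, LinearMap.smul_apply, bracket_T_Y, hβ,
      smul_smul, ← add_smul]
    rcases Y_cases (K := K) (n := n) (m := m) k with ⟨h, -⟩ | ⟨i, hi, -⟩
    · rw [h, smul_zero, smul_zero]
    · congr 1
      have hk : 1 ≤ k := by omega
      have hkn : k ≤ m := by omega
      clear hi
      induction k, hk using Nat.le_induction with
      | base => simp [wY]
      | succ k hk ih =>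
        rw [hY k hk hkn, ih (by omega)]
        simp [wY]
        ring

/-! ### A primitive modulo `c₁` and `c₂` -/

/-- The linear map `X_k ↦ a_k X_k`, `T_l ↦ t_l`, `Y_k ↦ b_k Y_k`. -/
noncomputable def diag (a : ℕ → K) (t : Fin 3 → SLSpace K n m) (b : ℕ → K) :
    SLSpace K n m →ₗ[K] SLSpace K n m :=
  (Pi.basisFun K (SLIndex n m)).constr K fun
    | .X i => a (i.val + 1) • X K n m (i.val + 1)
    | .T l => t l
    | .Y j => b (j.val + 1) • Y K n m (j.val + 1)

theorem diag_single (a : ℕ → K) (t : Fin 3 → SLSpace K n m) (b : ℕ → K) (e : SLIndex n m) :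
    diag a t b (Pi.single e 1) = match e with
      | .X i => a (i.val + 1) • X K n m (i.val + 1)
      | .T l => t l
      | .Y j => b (j.val + 1) • Y K n m (j.val + 1) := by
  rw [← Pi.basisFun_apply, diag, Module.Basis.constr_basis]

theorem diag_T (a : ℕ → K) (t : Fin 3 → SLSpace K n m) (b : ℕ → K) (l : Fin 3) :
    diag a t b (T K n m l) = t l := by
  rw [← single_T, diag_single]

theorem diag_X (a : ℕ → K) (t : Fin 3 → SLSpace K n m) (b : ℕ → K) (k : ℕ) :
    diag a t b (X K n m k) = a k • X K n m k := by
  rcases X_cases (K := K) (n := n) (m := m) k with ⟨h, -⟩ | ⟨i, rfl, -⟩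
  · rw [h, map_zero, smul_zero]
  · rw [← single_X, diag_single, single_X]

theorem diag_Y (a : ℕ → K) (t : Fin 3 → SLSpace K n m) (b : ℕ → K) (k : ℕ) :
    diag a t b (Y K n m k) = b k • Y K n m k := by
  rcases Y_cases (K := K) (n := n) (m := m) k with ⟨h, -⟩ | ⟨i, rfl, -⟩
  · rw [h, map_zero, smul_zero]
  · rw [← single_Y, diag_single, single_Y]

theorem c1_T (p : ℕ) (l : Fin 3) (a : SLIndex n m) :
    c1 K n m p (T K n m l) (Pi.single a 1) = 0 := by
  rw [← single_T, c1, bilin_single]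

theorem c2_T (p : ℕ) (l : Fin 3) (a : SLIndex n m) :
    c2 K n m p (T K n m l) (Pi.single a 1) = 0 := by
  rw [← single_T, c2, bilin_single]

/-- Modulo coboundaries, a weight-zero cocycle is a combination of `c₁` and `c₂`. -/
theorem IsWeightZero.exists_sub_mem_B2 (hw : IsWeightZero c) (hc : c ∈ (SL K n m).Z2) (p : ℕ)
    [CharP K p] (hp : 2 < p) (hn1 : 1 < n) (hn : n ≤ p + 1) (hm1 : 1 ≤ m) (hm : m ≤ p)
    (hc1 : c1 K n m p ∈ (SL K n m).Z2) (hc2 : c2 K n m p ∈ (SL K n m).Z2) :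
    ∃ r s : K, c - r • c1 K n m p - s • c2 K n m p ∈ (SL K n m).B2 := by
  have h2 := two_ne_zero_of_lt (K := K) p hp
  obtain ⟨s, hs⟩ := (hw.X_one_X p (by omega) hn1 hn le_rfl).2
  obtain ⟨r, hr⟩ := (hw.X_one_Y p hn1 hm1 hm le_rfl).2
  -- The range conditions sit inside the existential so that `choose` yields a total sequence.
  have exX : ∀ k, ∃ γ : K, 2 ≤ k → k ≠ p + 1 →
      c (X K n m 1) (X K n m k) = γ • X K n m (k + 1) := by
    intro k
    by_cases h : 2 ≤ k ∧ k ≠ p + 1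
    · obtain ⟨γ, hγ⟩ := (hw.X_one_X p (by omega) hn1 hn h.1).1 h.2
      exact ⟨γ, fun _ _ => hγ⟩
    · exact ⟨0, fun h1 h2 => absurd ⟨h1, h2⟩ h⟩
  have exY : ∀ k, ∃ δ : K, 1 ≤ k → k ≠ p →
      c (X K n m 1) (Y K n m k) = δ • Y K n m (k + 1) := by
    intro k
    by_cases h : 1 ≤ k ∧ k ≠ p
    · obtain ⟨γ, hγ⟩ := (hw.X_one_Y p hn1 hm1 hm h.1).1 h.2
      exact ⟨γ, fun _ _ => hγ⟩
    · exact ⟨0, fun h1 h2 => absurd ⟨h1, h2⟩ h⟩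
  choose γ hγ using exX
  choose δ hδ using exY
  choose t htT htX htY using hw.exists_inner hc p (by omega) hn1 hn hm
  -- Since `a 1 = 0`, the differential of `D` at `(X₁, X_k)` for `k ≥ 2` is `(a (k+1) - a k)
  -- X_{k+1}`, so partial sums of `γ` solve the equation. The same holds for `b` and `δ`.
  let a : ℕ → K := fun k => ∑ i ∈ Finset.Ico 2 k, γ i
  let b : ℕ → K := fun k => ∑ i ∈ Finset.Ico 1 k, δ i
  have ha : ∀ k, 2 ≤ k → a (k + 1) = a k + γ k := fun k hk => Finset.sum_Ico_succ_top hk _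
  have hb : ∀ k, 1 ≤ k → b (k + 1) = b k + δ k := fun k hk => Finset.sum_Ico_succ_top hk _
  have ha1 : a 1 = 0 := by simp [a]
  -- The sign of `t l` arises because the differential at `(T_l, x)` reduces to `[x, D T_l] = [t_l,
  -- x]`.
  let D : SLSpace K n m →ₗ[K] SLSpace K n m := diag a (fun l => -t l) b
  have hC2 : c - r • c1 K n m p - s • c2 K n m p ∈ (SL K n m).C2 :=
    sub_mem (sub_mem hc.1 (Submodule.smul_mem _ _ hc1.1)) (Submodule.smul_mem _ _ hc2.1)
  have apply : ∀ x y, (c - r • c1 K n m p - s • c2 K n m p) x y =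
      c x y - r • c1 K n m p x y - s • c2 K n m p x y := fun _ _ => rfl
  have TX : ∀ l k, c (T K n m l) (X K n m k) =
      (SL K n m).d1 D 0 0 (T K n m l) (X K n m k) := by
    intro l k
    rw [d1_zero_left, diag_T, diag_X, bracket_T_X, map_smul, map_smul, diag_X, bracket_T_X,
      smul_comm, sub_self, zero_add, map_neg, bracket_neg (X K n m k), neg_neg, htX]
  have TY : ∀ l k, c (T K n m l) (Y K n m k) =
      (SL K n m).d1 D 0 1 (T K n m l) (Y K n m k) := by
    intro l k
    rw [d1_zero_left, diag_T, diag_Y, bracket_T_Y, map_smul, map_smul, diag_Y, bracket_T_Y,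
      smul_comm, sub_self, zero_add, map_neg, bracket_neg (Y K n m k), neg_neg, htY]
  have TT : ∀ l l', c (T K n m l) (T K n m l') =
      (SL K n m).d1 D 0 0 (T K n m l) (T K n m l') := by
    intro l l'
    rw [d1_zero_left, diag_T, diag_T, bracket_T_T, map_neg, map_neg, htT, htT, map_zero,
      hw.T_T_eq_zero hc p (by omega) hn1 hn hm1 hm]
    simp
  have XX : ∀ i i' : Fin n, i.val ≤ i'.val →
      (c - r • c1 K n m p - s • c2 K n m p) (Pi.single (.X i) 1) (Pi.single (.X i') 1) =
        (SL K n m).d1 D 0 0 (Pi.single (.X i) 1) (Pi.single (.X i') 1) := by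
    intro i i' hii
    have e1 : c1 K n m p (Pi.single (.X i) 1) (Pi.single (.X i') 1) = 0 := by
      rw [c1, bilin_single]
    rw [apply, e1, smul_zero, sub_zero]
    by_cases hi : 1 ≤ i.val
    · have e2 : c2 K n m p (Pi.single (.X i) 1) (Pi.single (.X i') 1) = 0 := by
        rw [c2, bilin_single]
        exact (if_neg (by omega)).trans (if_neg (by omega))
      rw [e2, hw.X_X_eq_zero h2 hi (hi.trans hii), single_X, single_X, d1_zero_left,
        diag_X, diag_X, map_smul, map_smul, bracket_neg (X K n m (i'.val + 1)), bracket_X_X,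
        if_neg (by omega), if_neg (by omega)]
      simp
    · have hi0 : i.val + 1 = 1 := by omega
      by_cases hi' : 1 ≤ i'.val
      · have hd : (SL K n m).d1 D 0 0 (X K n m 1) (X K n m (i'.val + 1)) =
            γ (i'.val + 1) • X K n m (i'.val + 1 + 1) := by
          rw [d1_zero_left, diag_X, diag_X, map_smul, map_smul, ha1,
            bracket_X_X, if_pos ⟨rfl, by omega⟩, diag_X, ha _ (by omega)]
          module
        rw [c2, bilin_single]
        simp only [hi0, true_and]
        rw [single_X, single_X, hi0, hd]
        split_ifs with h h'
        -- At `k = p + 1` the vector `X_{p+2}` is zero, so the differential vanishes there and `s •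
        -- c₂` must absorb the whole value.
        · rw [h, hs, sub_self, X_eq_zero (k := p + 1 + 1) (by omega), smul_zero]
        · omega
        · rw [hγ _ (by omega) h, smul_zero, sub_zero]
      · obtain rfl : i' = i := Fin.ext (by omega)
        -- Cochains are only required to be skew; vanishing on the diagonal follows from `2 ≠ 0`.
        have skew := hc.1 0 0 _ _ (single_mem_part (K := K) (.X i' : SLIndex n m))
          (single_mem_part (.X i'))
        have hz : c (Pi.single (.X i') 1) (Pi.single (.X i') 1) = 0 := by
          have v0 : (0 : ZMod 2).val = 0 := rfl
          rw [v0, zero_mul, pow_zero, one_smul, eq_neg_iff_add_eq_zero, ← two_smul K] at skew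
          exact (smul_eq_zero.1 skew).resolve_left h2
        rw [hz, c2, bilin_single]
        simp only
        rw [if_neg (by omega), if_neg (by omega), single_X, hi0, d1_zero_left, bracket_X_X,
          if_neg (by omega), if_neg (by omega)]
        simp
  have XY : ∀ (i : Fin n) (j : Fin m),
      (c - r • c1 K n m p - s • c2 K n m p) (Pi.single (.X i) 1) (Pi.single (.Y j) 1) =
        (SL K n m).d1 D 0 1 (Pi.single (.X i) 1) (Pi.single (.Y j) 1) := by
    intro i j
    have e2 : c2 K n m p (Pi.single (.X i) 1) (Pi.single (.Y j) 1) = 0 := by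
      rw [c2, bilin_single]
    rw [apply, e2, smul_zero, sub_zero, c1, bilin_single]
    simp only
    by_cases hi : 1 ≤ i.val
    · rw [if_neg (by omega), hw.X_Y_eq_zero hi, single_X, single_Y, d1_zero_left,
        diag_X, diag_Y, map_smul, map_smul, bracket_neg (Y K n m (j.val + 1)), bracket_X_Y,
        if_neg (by omega)]
      simp
    · have hi0 : i.val + 1 = 1 := by omega
      have hd : (SL K n m).d1 D 0 1 (X K n m 1) (Y K n m (j.val + 1)) =
          δ (j.val + 1) • Y K n m (j.val + 1 + 1) := by
        rw [d1_zero_left, diag_X, diag_Y, map_smul, map_smul, ha1, bracket_X_Y,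
          if_pos ⟨rfl, by omega, by omega⟩, diag_Y, hb _ (by omega)]
        module
      simp only [hi0, true_and]
      rw [single_X, single_Y, hi0, hd]
      split_ifs with h
      · rw [h, hr, sub_self, Y_eq_zero (k := p + 1) (by omega), smul_zero]
      · rw [hδ _ (by omega) h, smul_zero, sub_zero]
  have YY : ∀ j j' : Fin m,
      (c - r • c1 K n m p - s • c2 K n m p) (Pi.single (.Y j) 1) (Pi.single (.Y j') 1) =
        (SL K n m).d1 D 1 1 (Pi.single (.Y j) 1) (Pi.single (.Y j') 1) := by
    intro j j'
    have e1 : c1 K n m p (Pi.single (.Y j) 1) (Pi.single (.Y j') 1) = 0 := by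
      rw [c1, bilin_single]
    have e2 : c2 K n m p (Pi.single (.Y j) 1) (Pi.single (.Y j') 1) = 0 := by
      rw [c2, bilin_single]
    have hB : (SL K n m).bracket = bracket K n m := rfl
    rw [apply, e1, e2, hw.Y_Y_eq_zero h2, single_Y, single_Y, LieSuperalgebra.d1, hB, diag_Y,
      diag_Y, map_smul, map_smul, bracket_Y_Y, bracket_Y_Y]
    simp
  refine ⟨r, s, mem_B2_of_single_or hC2 D fun e e' => ?_⟩
  rcases e with i | l | j <;> rcases e' with i' | l' | j'
  · rcases le_total i.val i'.val with h | h
    · exact .inl (XX i i' h)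
    · exact .inr (XX i' i h)
  · refine .inr ?_
    rw [apply, single_T, c1_T, c2_T, smul_zero, smul_zero, sub_zero, sub_zero, single_X]
    exact TX l' _
  · exact .inl (XY i j')
  · refine .inl ?_
    rw [apply, single_T, c1_T, c2_T, smul_zero, smul_zero, sub_zero, sub_zero, single_X]
    exact TX l _
  · refine .inl ?_
    rw [apply, single_T, c1_T, c2_T, smul_zero, smul_zero, sub_zero, sub_zero, single_T]
    exact TT l l'
  · refine .inl ?_
    rw [apply, single_T, c1_T, c2_T, smul_zero, smul_zero, sub_zero, sub_zero, single_Y]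
    exact TY l _
  · exact .inr (XY i' j)
  · refine .inr ?_
    rw [apply, single_T, c1_T, c2_T, smul_zero, smul_zero, sub_zero, sub_zero, single_Y]
    exact TY l' _
  · exact .inl (YY j j')

/-! ### Independence of the classes -/

theorem c1_X_one_Y {p : ℕ} (hn : 0 < n) (hp : 1 ≤ p) (hm : p ≤ m) :
    c1 K n m p (X K n m 1) (Y K n m p) = Y K n m 1 := by
  obtain ⟨q, rfl⟩ : ∃ q, p = q + 1 := ⟨p - 1, by omega⟩
  have h := bilin_single (K := K) (n := n) (m := m) (fun
    | .X i, .Y j => if i.val + 1 = 1 ∧ j.val + 1 = q + 1 then Y K n m 1 else 0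
    | .Y j, .X i => if i.val + 1 = 1 ∧ j.val + 1 = q + 1 then -Y K n m 1 else 0
    | _, _ => 0) (.X ⟨0, hn⟩) (.Y ⟨q, hm⟩)
  rw [single_X, single_Y] at h
  exact h.trans (if_pos ⟨rfl, rfl⟩)

theorem c2_X_one_X {p : ℕ} (hn : p < n) :
    c2 K n m p (X K n m 1) (X K n m (p + 1)) = X K n m 2 := by
  have h := bilin_single (K := K) (n := n) (m := m) (fun
    | .X i, .X i' =>
        if i.val + 1 = 1 ∧ i'.val + 1 = p + 1 then X K n m 2
        else if i.val + 1 = p + 1 ∧ i'.val + 1 = 1 then -X K n m 2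
        else 0
    | _, _ => 0) (.X ⟨0, by omega⟩) (.X ⟨p, hn⟩)
  rw [single_X, single_X] at h
  exact h.trans (if_pos ⟨rfl, rfl⟩)

/-- The vectors `Y₁` and, in the next lemma, `X₂` are generators: they do not occur in the image of
the adjoint action of `X₁`. -/
theorem bracket_X_one_apply_Y (j : Fin m) (hj : j.val = 0) (v : SLSpace K n m) :
    bracket K n m (X K n m 1) v (.Y j) = 0 := by
  have h : LinearMap.proj (.Y j) ∘ₗ bracket K n m (X K n m 1) = 0 := by
    refine eq_of_single_left fun a => ?_
    simp only [LinearMap.comp_apply, LinearMap.proj_apply]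
    rcases a with i | l | j' <;>
      simp only [single_X, single_T, single_Y, bracket_X_X, bracket_X_T, bracket_X_Y, ite_apply,
        Pi.neg_apply, Pi.smul_apply, Pi.zero_apply, LinearMap.zero_apply, X_apply_Y, Y_apply_Y]
    all_goals (try split_ifs) <;> first | omega | simp
  exact LinearMap.congr_fun h v

theorem bracket_X_one_apply_X (i : Fin n) (hi : i.val = 1) (v : SLSpace K n m) :
    bracket K n m (X K n m 1) v (.X i) = 0 := by
  have h : LinearMap.proj (.X i) ∘ₗ bracket K n m (X K n m 1) = 0 := by
    refine eq_of_single_left fun a => ?_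
    simp only [LinearMap.comp_apply, LinearMap.proj_apply]
    rcases a with i | l | j' <;>
      simp only [single_X, single_T, single_Y, bracket_X_X, bracket_X_T, bracket_X_Y, ite_apply,
        Pi.neg_apply, Pi.smul_apply, Pi.zero_apply, LinearMap.zero_apply, X_apply_X, Y_apply_X]
    all_goals (try split_ifs) <;> first | omega | simp
  exact LinearMap.congr_fun h v

/-- The image of the adjoint action of `Y_k` lies in the span of `Y_k` and `Y_{k+1}`, which misses
`Y₁` once `k ≥ 2`. -/
theorem bracket_Y_apply_Y {k : ℕ} (hk : 2 ≤ k) (j : Fin m) (hj : j.val = 0)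
    (v : SLSpace K n m) : bracket K n m (Y K n m k) v (.Y j) = 0 := by
  have h : LinearMap.proj (.Y j) ∘ₗ bracket K n m (Y K n m k) = 0 := by
    refine eq_of_single_left fun a => ?_
    simp only [LinearMap.comp_apply, LinearMap.proj_apply]
    rcases a with i | l | j' <;>
      simp only [single_X, single_T, single_Y, bracket_Y_X, bracket_Y_T, bracket_X_Y, bracket_Y_Y,
        ite_apply, Pi.neg_apply, Pi.smul_apply, Pi.zero_apply, LinearMap.zero_apply, Y_apply_Y]
    all_goals (try split_ifs) <;> first | omega | simp
  exact LinearMap.congr_fun h v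

theorem bracket_X_apply_X {k : ℕ} (hk : 3 ≤ k) (i : Fin n) (hi : i.val = 1)
    (v : SLSpace K n m) : bracket K n m (X K n m k) v (.X i) = 0 := by
  have h : LinearMap.proj (.X i) ∘ₗ bracket K n m (X K n m k) = 0 := by
    refine eq_of_single_left fun a => ?_
    simp only [LinearMap.comp_apply, LinearMap.proj_apply]
    rcases a with i | l | j' <;>
      simp only [single_X, single_T, single_Y, bracket_X_X, bracket_X_T, bracket_X_Y, ite_apply,
        Pi.neg_apply, Pi.smul_apply, Pi.zero_apply, LinearMap.zero_apply, X_apply_X, Y_apply_X]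
    all_goals (try split_ifs) <;> first | omega | simp
  exact LinearMap.congr_fun h v

/-- The `Y₁`-coefficient at `(X₁, Y_p)` is compared. On the coboundary side `b` is applied to `[X₁,
Y_p] = Y_{p+1}`, which is zero as `m = p`, and the other two terms lie in images that miss `Y₁`. -/
theorem coeff_c1_eq_zero {p : ℕ} (hp : 2 ≤ p) (hn : 0 < n) (hm : m = p) {r s : K}
    (h : r • c1 K n m p + s • c2 K n m p ∈ (SL K n m).B2) : r = 0 := by
  obtain ⟨b, hb⟩ := h
  have h1 := congrFun (hb 0 1 _ _ (X_mem_part 1) (Y_mem_part p)) (.Y ⟨0, by omega⟩)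
  have e2 : c2 K n m p (X K n m 1) (Y K n m p) = 0 := by
    rcases X_cases (K := K) (n := n) (m := m) 1 with ⟨h, -⟩ | ⟨i, -, h⟩
    · rw [h, map_zero, LinearMap.zero_apply]
    rcases Y_cases (K := K) (n := n) (m := m) p with ⟨h', -⟩ | ⟨j, -, h'⟩
    · rw [h', map_zero]
    · rw [h, h', c2, bilin_single]
  rw [LinearMap.add_apply, LinearMap.add_apply, LinearMap.smul_apply, LinearMap.smul_apply,
    LinearMap.smul_apply, LinearMap.smul_apply, c1_X_one_Y hn (by omega) hm.ge, e2, d1_zero_left,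
    bracket_X_Y, if_pos ⟨rfl, by omega, hn⟩, Y_eq_zero (k := p + 1) (by omega), map_zero,
    Pi.add_apply, Pi.add_apply, Pi.sub_apply, bracket_X_one_apply_Y _ rfl,
    bracket_Y_apply_Y hp _ rfl] at h1
  simpa [Y_apply_Y] using h1

theorem coeff_c2_eq_zero {p : ℕ} (hp : 2 ≤ p) (hn : n = p + 1) {r s : K}
    (h : r • c1 K n m p + s • c2 K n m p ∈ (SL K n m).B2) : s = 0 := by
  obtain ⟨b, hb⟩ := h
  have h1 := congrFun (hb 0 0 _ _ (X_mem_part 1) (X_mem_part (p + 1))) (.X ⟨1, by omega⟩)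
  have e1 : c1 K n m p (X K n m 1) (X K n m (p + 1)) = 0 := by
    rcases X_cases (K := K) (n := n) (m := m) 1 with ⟨h, -⟩ | ⟨i, -, h⟩
    · rw [h, map_zero, LinearMap.zero_apply]
    rcases X_cases (K := K) (n := n) (m := m) (p + 1) with ⟨h', -⟩ | ⟨j, -, h'⟩
    · rw [h', map_zero]
    · rw [h, h', c1, bilin_single]
  rw [LinearMap.add_apply, LinearMap.add_apply, LinearMap.smul_apply, LinearMap.smul_apply,
    LinearMap.smul_apply, LinearMap.smul_apply, c2_X_one_X (by omega), e1, d1_zero_left,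
    bracket_X_X, if_pos ⟨rfl, by omega⟩, X_eq_zero (k := p + 1 + 1) (by omega), map_zero,
    Pi.add_apply, Pi.add_apply, Pi.sub_apply, bracket_X_one_apply_X _ rfl,
    bracket_X_apply_X (by omega) _ rfl] at h1
  simpa [X_apply_X] using h1

/-! ### Assembling the four cases -/

/-- For `m < p` the map `c₁` is zero, so no lower bound on `m` is needed. One spanning statement
then serves all four cases, with absent classes equal to zero. -/
theorem c1_mem_Z2 {p : ℕ} [CharP K p] (hp : 2 ≤ p) (hn : 0 < n) :
    c1 K n m p ∈ (SL K n m).Z2 := by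
  rcases lt_or_ge m p with h | h
  · rw [c1_eq_zero h]
    exact zero_mem _
  · exact c1_mem_Z2_of_le hp hn h

theorem c2_mem_Z2 {p : ℕ} [CharP K p] (hp : 2 ≤ p) : c2 K n m p ∈ (SL K n m).Z2 := by
  rcases lt_or_ge n (p + 1) with h | h
  · rw [c2_eq_zero h]
    exact zero_mem _
  · exact c2_mem_Z2_of_lt hp h

/-- The classes of `c₁` and `c₂` span `H²(SL^{n,m}; SL^{n,m})` for `n ≤ p + 1` and `m ≤ p`. -/
theorem exists_eq_add {p : ℕ} [CharP K p] (hp : 2 < p) (hpp : p.Prime) (hn1 : 1 < n)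
    (hn : n ≤ p + 1) (hm1 : 1 ≤ m) (hm : m ≤ p) (h₁ : c1 K n m p ∈ (SL K n m).Z2)
    (h₂ : c2 K n m p ∈ (SL K n m).Z2) (z : (SL K n m).H2) :
    ∃ r s : K, r • (SL K n m).cls _ h₁ + s • (SL K n m).cls _ h₂ = z := by
  have := Fact.mk hpp
  obtain ⟨⟨c, hc⟩, rfl⟩ := Submodule.mkQ_surjective _ z
  obtain ⟨c', hc', hB, hw⟩ := exists_isWeightZero p hc
  obtain ⟨r, s, hrs⟩ := hw.exists_sub_mem_B2 hc' p hp hn1 hn hm1 hm h₁ h₂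
  refine ⟨r, s, ?_⟩
  rw [LieSuperalgebra.cls, LieSuperalgebra.cls, ← map_smul, ← map_smul, ← map_add, eq_comm,
    ← sub_eq_zero, ← map_sub, Submodule.mkQ_apply, Submodule.Quotient.mk_eq_zero,
    Submodule.mem_comap]
  -- The difference from `r • c₁ + s • c₂` splits as `c - c'` plus the corresponding difference for
  -- the weight-zero representative `c'`.
  convert add_mem hB hrs using 1
  simp only [Submodule.subtype_apply, Submodule.coe_sub, Submodule.coe_add, Submodule.coe_smul]
  abel

theorem add_cls_eq_zero_iff {p : ℕ} (h₁ : c1 K n m p ∈ (SL K n m).Z2)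
    (h₂ : c2 K n m p ∈ (SL K n m).Z2) (r s : K) :
    r • (SL K n m).cls _ h₁ + s • (SL K n m).cls _ h₂ = 0 ↔
      r • c1 K n m p + s • c2 K n m p ∈ (SL K n m).B2 := by
  rw [LieSuperalgebra.cls, LieSuperalgebra.cls, ← map_smul, ← map_smul, ← map_add,
    Submodule.mkQ_apply, Submodule.Quotient.mk_eq_zero, Submodule.mem_comap]
  rfl

theorem cls_eq_zero_of_eq_zero {c : SLSpace K n m →ₗ[K] SLSpace K n m →ₗ[K] SLSpace K n m}
    (hc : c ∈ (SL K n m).Z2) (h : c = 0) : (SL K n m).cls c hc = 0 := by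
  subst h
  exact map_zero _

end SLSpace

theorem finrank_and_span_of_forall_smul {K V : Type*} [Field K] [AddCommGroup V] [Module K V]
    (v : V) (hv : v ≠ 0) (h : ∀ z, ∃ r : K, r • v = z) :
    Module.finrank K V = 1 ∧ Submodule.span K {v} = ⊤ :=
  ⟨finrank_eq_one v hv h, by
    rw [eq_top_iff]
    exact fun z _ => Submodule.mem_span_singleton.2 (h z)⟩

/-- The second adjoint cohomology of `SL^{n,m}` in characteristic `3, 5, 7, 11`. -/
theorem claim6p1 {K : Type*} [Field K] (p : ℕ) [CharP K p]
    (hp : p = 3 ∨ p = 5 ∨ p = 7 ∨ p = 11) (n m : ℕ) (hn : 1 < n) (hm : 1 ≤ m) :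
    (m < p → n < p + 1 → Subsingleton (SL K n m).H2) ∧
    (m = p → n < p + 1 →
      (SL K n m).IsEven (SLSpace.c1 K n m p) ∧
      SLSpace.HasDegree (SLSpace.c1 K n m p) (-(p : ℤ)) ∧
      Module.finrank K (SL K n m).H2 = 1 ∧
      ∃ h₁ : SLSpace.c1 K n m p ∈ (SL K n m).Z2,
        Submodule.span K {(SL K n m).cls (SLSpace.c1 K n m p) h₁} = ⊤) ∧
    (m < p → n = p + 1 →
      (SL K n m).IsEven (SLSpace.c2 K n m p) ∧
      SLSpace.HasDegree (SLSpace.c2 K n m p) (-(p : ℤ)) ∧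
      Module.finrank K (SL K n m).H2 = 1 ∧
      ∃ h₂ : SLSpace.c2 K n m p ∈ (SL K n m).Z2,
        Submodule.span K {(SL K n m).cls (SLSpace.c2 K n m p) h₂} = ⊤) ∧
    (m = p → n = p + 1 →
      (SL K n m).IsEven (SLSpace.c1 K n m p) ∧
      SLSpace.HasDegree (SLSpace.c1 K n m p) (-(p : ℤ)) ∧
      (SL K n m).IsEven (SLSpace.c2 K n m p) ∧
      SLSpace.HasDegree (SLSpace.c2 K n m p) (-(p : ℤ)) ∧
      Module.finrank K (SL K n m).H2 = 2 ∧
      ∃ (h₁ : SLSpace.c1 K n m p ∈ (SL K n m).Z2) (h₂ : SLSpace.c2 K n m p ∈ (SL K n m).Z2),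
        Submodule.span K {(SL K n m).cls (SLSpace.c1 K n m p) h₁,
          (SL K n m).cls (SLSpace.c2 K n m p) h₂} = ⊤) := by
  have hpp : p.Prime := by rcases hp with rfl | rfl | rfl | rfl <;> norm_num
  have hp2 : 2 < p := by omega
  have h₁ : SLSpace.c1 K n m p ∈ (SL K n m).Z2 :=
    SLSpace.c1_mem_Z2 hp2.le (by omega)
  have h₂ : SLSpace.c2 K n m p ∈ (SL K n m).Z2 := SLSpace.c2_mem_Z2 hp2.le
  have hspan := fun hn' hm' => SLSpace.exists_eq_add hp2 hpp hn hn' hm hm' h₁ h₂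
  have hzero := SLSpace.add_cls_eq_zero_iff h₁ h₂
  have z₁ := fun h : m < p => SLSpace.cls_eq_zero_of_eq_zero h₁ (SLSpace.c1_eq_zero h)
  have z₂ := fun h : n < p + 1 => SLSpace.cls_eq_zero_of_eq_zero h₂ (SLSpace.c2_eq_zero h)
  have i₁ := fun (h : m = p) (r s : K) hrs =>
    SLSpace.coeff_c1_eq_zero hp2.le (by omega) h ((hzero r s).1 hrs)
  have i₂ := fun (h : n = p + 1) (r s : K) hrs =>
    SLSpace.coeff_c2_eq_zero hp2.le h ((hzero r s).1 hrs)
  refine ⟨fun hmp hnp => ?_, fun hmp hnp => ?_, fun hmp hnp => ?_, fun hmp hnp => ?_⟩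
  · refine subsingleton_of_forall_eq 0 fun z => ?_
    obtain ⟨r, s, rfl⟩ := hspan hnp.le hmp.le z
    rw [z₁ hmp, z₂ hnp, smul_zero, smul_zero, add_zero]
  · obtain ⟨hr, hs⟩ := finrank_and_span_of_forall_smul (K := K)
      ((SL K n m).cls (SLSpace.c1 K n m p) h₁)
      (fun h => one_ne_zero (i₁ hmp 1 0 (by rw [h, smul_zero, zero_smul, add_zero])))
      (fun z => by
        obtain ⟨r, s, rfl⟩ := hspan hnp.le hmp.le z
        exact ⟨r, by rw [z₂ hnp, smul_zero, add_zero]⟩)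
    exact ⟨SLSpace.c1_isEven p, SLSpace.c1_hasDegree p, hr, h₁, hs⟩
  · obtain ⟨hr, hs⟩ := finrank_and_span_of_forall_smul (K := K)
      ((SL K n m).cls (SLSpace.c2 K n m p) h₂)
      (fun h => one_ne_zero (i₂ hnp 0 1 (by rw [h, smul_zero, zero_smul, add_zero])))
      (fun z => by
        obtain ⟨r, s, rfl⟩ := hspan hnp.le hmp.le z
        exact ⟨s, by rw [z₁ hmp, smul_zero, zero_add]⟩)
    exact ⟨SLSpace.c2_isEven p, SLSpace.c2_hasDegree p, hr, h₂, hs⟩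
  · have hs : Submodule.span K {(SL K n m).cls (SLSpace.c1 K n m p) h₁,
        (SL K n m).cls (SLSpace.c2 K n m p) h₂} = ⊤ := by
      rw [eq_top_iff]
      exact fun z _ => Submodule.mem_span_pair.2 (hspan hnp.le hmp.le z)
    have hi : LinearIndependent K ![(SL K n m).cls (SLSpace.c1 K n m p) h₁,
        (SL K n m).cls (SLSpace.c2 K n m p) h₂] :=
      LinearIndependent.pair_iff.2 fun r s hrs => ⟨i₁ hmp r s hrs, i₂ hnp r s hrs⟩
    refine ⟨SLSpace.c1_isEven p, SLSpace.c1_hasDegree p, SLSpace.c2_isEven p,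
      SLSpace.c2_hasDegree p, ?_, h₁, h₂, hs⟩
    have hr := finrank_span_eq_card hi
    rwa [Matrix.range_cons, Matrix.range_cons, Matrix.range_empty, Set.union_empty,
      Set.singleton_union, hs, finrank_top, Fintype.card_fin] at hr
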